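/- Let $\rho_l,\mu_l,\sigma,T_\infty,p_\infty,\mathcal R_g,c_v,R_*>0$ and $\kappa\ge0$ be constants, and put $\gamma=1+\mathcal R_g/c_v$, $p_*=p_\infty+2\sigma/R_*$, $\rho_*=p_*/(\mathcal R_gT_\infty)$. Let $B_1\subset\mathbb R^3$ be the unit ball, $r=|y|$, and $\Delta_S$ the Laplace–Beltrami operator of $\mathbb S^2=\partial B_1$. Consider the linearization, at a spherical equilibrium bubble of radius $R_*$, of the isobaric gas bubble in a viscous irrotational liquid, with unknowns $\mathcal R(\theta,\varphi,t)$, $\Phi_l(y,t)$, $\varrho(y,t)$ together with $\mathcal P_l(y,t)$, $\Phi_g(y,t)$, $\mathcal P_g(t)$: for $t>0$, $$\partial_t\Phi_l=-\frac{1}{\rho_lR_*}\mathcal P_l,\qquad \Delta\Phi_l=0\qquad\text{in } |y|>1,$$ $$\partial_t\varrho+\frac{\rho_*}{R_*}\Delta\Phi_g=0,\qquad \partial_t\varrho=\frac{\kappa}{\gamma c_v}\frac{1}{\rho_*R_*^2}\Delta\varrho+\frac{\rho_*}{\gamma p_*}\,\partial_t\mathcal P_g\qquad\text{in } B_1,$$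 and on $\partial B_1$ $$\partial_r\Phi_l=\partial_r\Phi_g=\partial_t\mathcal R,\qquad \mathcal P_g-\mathcal P_l+\frac{2\mu_l}{R_*^2}\partial_r^2\Phi_l=-\frac{\sigma}{R_*^2}(2+\Delta_S)\mathcal R,$$ $$\partial_\theta\partial_r\Phi_l-\partial_\theta\Phi_l=0,\qquad \partial_\varphi\partial_r\Phi_l-\partial_\varphi\Phi_l=0,\qquad \mathcal P_g=\mathcal R_gT_\infty\,\varrho,$$ with $\nabla\Phi_l=O(|y|^{-2})$, $D^2\Phi_l\to0$, $\mathcal P_l\to0$ as $|y|\to\infty$, and with $\mathcal R(\cdot,t)$ orthogonal in $L^2(\mathbb S^2)$ to the spherical harmonics of degree one. Let $(\mathcal R,\Phi_l,\varrho)$ be a solution that is $C^1$ in time on $[0,\infty)$ (in particular continuous up to $t=0$), where $\mathcal R$ takes values in $L^2(\mathbb S^2)$, $\varrho$ in $L^2(B_1)$, and $\Phi_l$ in the harmonic functions on $|y|>1$ with the above decay that are in $L^2(\{1<|y|<\rho\})$ for every $\rho>1$ (with these $L^2$ norms). The equations hold in the sense of distributions, with the conditions on $\partial B_1$ understood as distributional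 boundary values (classical solutions, regular up to $\partial B_1$, are included); the conditions with $\partial_\theta,\partial_\varphi$ mean that the tangential gradient of $\partial_r\Phi_l-\Phi_l$ vanishes on all of $\partial B_1$. Then $\Phi_l=\Phi_l(r,t)$ and $\mathcal R=\mathcal R(t)$ are independent of $\theta$ and $\varphi$ for all $t\ge0$. In particular, at $t=0$, the initial data $\mathcal R(\cdot,0)$ and $\Phi_l(\cdot,0)$ of such a solution are radially symmetric. -/

import Mathlib

open MeasureTheory Set Filter Topology Metric
open scoped ContDiff

noncomputable section

namespace Bubble

/-- Three-dimensional Euclidean space. -/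
abbrev E3 : Type := EuclideanSpace ℝ (Fin 3)

/-- The unit sphere `∂B₁`. -/
abbrev S2 : Type := Metric.sphere (0 : E3) 1

/-- The surface measure on the unit sphere (of total mass `4π`). -/
abbrev surf : Measure S2 := (volume : Measure E3).toSphere

/-- Lebesgue measure on the open unit ball `B₁`. -/
abbrev ballMeas : Measure E3 := volume.restrict (Metric.ball (0 : E3) 1)

/-- The open exterior `|y| > 1` of the closed unit ball. -/
def exterior : Set E3 := {y | 1 < ‖y‖}

/-- Lebesgue measure on the shell `1 < |y| < ρ`. -/
abbrev shellMeas (ρ : ℝ) : Measure E3 := volume.restrict {y : E3 | 1 < ‖y‖ ∧ ‖y‖ < ρ}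

/-- The independent physical constants. `rhoL`, `muL` are the density and viscosity of the liquid,
`kappa` the thermal conductivity of the gas, `sigma` the surface tension, `Tinf` and `pInf` the
far-field temperature and pressure, `Rgas` the specific gas constant, `cv` the heat capacity of
the gas at constant volume, `Rstar` the radius of the spherical equilibrium bubble. -/
structure Params where
  rhoL : ℝ
  muL : ℝ
  kappa : ℝ
  sigma : ℝ
  Tinf : ℝ
  pInf : ℝ
  Rgas : ℝ
  cv : ℝ
  Rstar : ℝ
  rhoL_pos : 0 < rhoL
  muL_nonneg : 0 ≤ muL
  kappa_nonneg : 0 ≤ kappa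
  sigma_pos : 0 < sigma
  Tinf_pos : 0 < Tinf
  pInf_pos : 0 < pInf
  Rgas_pos : 0 < Rgas
  cv_pos : 0 < cv
  Rstar_pos : 0 < Rstar

namespace Params

/-- The adiabatic constant `γ = 1 + Rg / c_v`. -/
def gam (p : Params) : ℝ := 1 + p.Rgas / p.cv

/-- The equilibrium gas pressure `p_* = p_∞ + 2σ / R_*`. -/
def pstar (p : Params) : ℝ := p.pInf + 2 * p.sigma / p.Rstar

/-- The equilibrium gas density `ρ_* = p_* / (Rg T_∞)`. -/
def rhostar (p : Params) : ℝ := p.pstar / (p.Rgas * p.Tinf)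

end Params

/-- The radial derivative `∂_r f (y) = (y / |y|) · ∇f (y)`. -/
def radDeriv (f : E3 → ℝ) (y : E3) : ℝ := fderiv ℝ f y (‖y‖⁻¹ • y)

/-- The angular derivative `(y_i ∂_j - y_j ∂_i) f (y)`. These rotation fields span the tangent
plane of every sphere centred at `0`, on which `∂_φ` is the one with `(i, j) = (0, 1)` and
`∂_θ` is the combination `cos φ (y_2 ∂_0 - y_0 ∂_2) - sin φ (y_1 ∂_2 - y_2 ∂_1)`, so that all of
them vanish together exactly when `∂_θ` and `∂_φ` do. -/
def angDeriv (i j : Fin 3) (f : E3 → ℝ) (y : E3) : ℝ :=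
  y i * fderiv ℝ f y (EuclideanSpace.single j 1) - y j * fderiv ℝ f y (EuclideanSpace.single i 1)

/-- The Laplace-Beltrami operator of the unit sphere applied to the restriction of `ψ` to the
sphere: the Laplacian of the extension that is homogeneous of degree `0`. -/
def sphLaplacian (ψ : E3 → ℝ) (x : S2) : ℝ :=
  Laplacian.laplacian (fun y : E3 => ψ (‖y‖⁻¹ • y)) (x : E3)

/-- `f` restricted to the sphere of radius `r` tends, as `r ↓ 1`, to the distribution `T` on the
unit sphere: the boundary value on `∂B₁`, in the sense of distributions, of a function on the
exterior. The restrictions of smooth functions `ψ` on the whole space are exactly the smooth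
functions on the sphere. -/
def HasBdryValue (f : E3 → ℝ) (T : (E3 → ℝ) → ℝ) : Prop :=
  ∀ ψ : E3 → ℝ, ContDiff ℝ ∞ ψ →
    Tendsto (fun r : ℝ => ∫ x : S2, f (r • (x : E3)) * ψ x ∂surf) (𝓝[>] 1) (𝓝 (T ψ))

/-- The function `f` on the open unit ball has the constant boundary value `c` on `∂B₁`: its
averages over the layers `r < |y| < 1`, tested against smooth functions, converge as `r ↑ 1`. -/
def HasConstTrace (f : E3 → ℝ) (c : ℝ) : Prop :=
  ∀ ψ : E3 → ℝ, ContDiff ℝ ∞ ψ →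
    Tendsto (fun r : ℝ => (1 - r)⁻¹ * ∫ y in {y : E3 | r < ‖y‖ ∧ ‖y‖ < 1}, f y * ψ y)
      (𝓝[<] 1) (𝓝 (c * ∫ x : S2, ψ x ∂surf))

/-- The liquid potentials `Φ` at a fixed time that the state space admits: `Φ` is harmonic in the
exterior, square integrable on every shell `1 < |y| < ρ`, and as `|y| → ∞` one has
`∇Φ = O(|y|⁻²)` and `D²Φ → 0`. -/
structure IsLiquidPotential (Φ : E3 → ℝ) : Prop where
  harmonic : InnerProductSpace.HarmonicOnNhd Φ exterior
  sq_integrable : ∀ ρ : ℝ, 1 < ρ → MemLp Φ 2 (shellMeas ρ)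
  grad_decay : (fun y => fderiv ℝ Φ y) =O[Bornology.cobounded E3] (fun y => ‖y‖ ^ (-2 : ℤ))
  hess_decay : Tendsto (fun y => fderiv ℝ (fderiv ℝ Φ) y) (Bornology.cobounded E3) (𝓝 0)

/-- `(ℛ, Φ_l, ϱ)` is continuously differentiable on `[0, ∞)` with values in the state space
(`L²(S²)` for `ℛ`, the above potentials with the `L²` norms of shells for `Φ_l`, and `L²(B₁)`
for `ϱ`). -/
structure IsC1State (R : ℝ → Lp ℝ 2 surf) (Φ : ℝ → E3 → ℝ) (rho : ℝ → Lp ℝ 2 ballMeas) :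
    Prop where
  R_C1 : ContDiffOn ℝ 1 R (Ici 0)
  rho_C1 : ContDiffOn ℝ 1 rho (Ici 0)
  Phi_mem : ∀ t : ℝ, 0 ≤ t → IsLiquidPotential (Φ t)
  Phi_C1 : ∀ ρ : ℝ, 1 < ρ → ∃ u : ℝ → Lp ℝ 2 (shellMeas ρ),
    ContDiffOn ℝ 1 u (Ici 0) ∧ ∀ t : ℝ, 0 ≤ t → u t =ᵐ[shellMeas ρ] Φ t

/-- The equations at time `t > 0`, for the state `(ℛ, Φ_l, ϱ)`, the liquid pressure `𝒫_l`, the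
gas pressure `𝒫_g` and the gas potential `Φ_g`. -/
structure EquationsAt (p : Params) (R : ℝ → Lp ℝ 2 surf) (Φ : ℝ → E3 → ℝ)
    (rho : ℝ → Lp ℝ 2 ballMeas) (Pl : ℝ → E3 → ℝ) (Pg : ℝ → ℝ) (Φg : ℝ → E3 → ℝ) (t : ℝ) :
    Prop where
  /-- `∂_t Φ_l = - 𝒫_l / (ρ_l R_*)` in `|y| > 1` -/
  bernoulli : ∀ y ∈ exterior, HasDerivAt (fun s => Φ s y) (-(1 / (p.rhoL * p.Rstar)) * Pl t y) t
  /-- `𝒫_l → 0` as `|y| → ∞` -/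
  pressure_decay : Tendsto (Pl t) (Bornology.cobounded E3) (𝓝 0)
  /-- `∂_t 𝒫_g` exists -/
  gas_pressure : DifferentiableAt ℝ Pg t
  gas_potential : MemLp (Φg t) 2 ballMeas
  /-- `∂_t ϱ + (ρ_* / R_*) Δ Φ_g = 0` in `B₁` and `∂_r Φ_g = ∂_t ℛ` on `∂B₁`, in the sense of
  distributions: Green's identity against test functions with vanishing normal derivative -/
  gas_mass : ∀ ψ : E3 → ℝ, ContDiff ℝ ∞ ψ → (∀ x : S2, radDeriv ψ x = 0) →
    ∫ y, Φg t y * Laplacian.laplacian ψ y ∂ballMeas =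
      -(p.Rstar / p.rhostar) * ∫ y, (deriv rho t : Lp ℝ 2 ballMeas) y * ψ y ∂ballMeas
        - ∫ x : S2, (deriv R t : Lp ℝ 2 surf) x * ψ x ∂surf
  /-- `∂_t ϱ = κ / (γ c_v ρ_* R_*²) Δ ϱ + ρ_* / (γ p_*) ∂_t 𝒫_g` in `B₁`, in the sense of
  distributions -/
  gas_heat : ∀ ψ : E3 → ℝ, ContDiff ℝ ∞ ψ → HasCompactSupport ψ →
    tsupport ψ ⊆ Metric.ball (0 : E3) 1 →
    ∫ y, (deriv rho t : Lp ℝ 2 ballMeas) y * ψ y ∂ballMeas =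
      p.kappa / (p.gam * p.cv) * (1 / (p.rhostar * p.Rstar ^ 2)) *
          ∫ y, (rho t : Lp ℝ 2 ballMeas) y * Laplacian.laplacian ψ y ∂ballMeas
        + p.rhostar / (p.gam * p.pstar) * deriv Pg t * ∫ y, ψ y ∂ballMeas
  /-- `∂_r Φ_l = ∂_t ℛ` on `∂B₁` -/
  kinematic : HasBdryValue (radDeriv (Φ t))
    (fun ψ => ∫ x : S2, (deriv R t : Lp ℝ 2 surf) x * ψ x ∂surf)
  /-- `𝒫_g - 𝒫_l + (2 μ_l / R_*²) ∂_r² Φ_l = - (σ / R_*²) (2 + Δ_S) ℛ` on `∂B₁` -/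
  normal_stress : HasBdryValue
    (fun y => Pg t - Pl t y + 2 * p.muL / p.Rstar ^ 2 * radDeriv (radDeriv (Φ t)) y)
    (fun ψ => -(p.sigma / p.Rstar ^ 2) *
      ∫ x : S2, (R t : Lp ℝ 2 surf) x * (2 * ψ x + sphLaplacian ψ x) ∂surf)
  /-- if `μ_l > 0`, the tangential derivatives of `∂_r Φ_l - Φ_l` vanish on `∂B₁` -/
  tangential_stress : 0 < p.muL → ∀ i j : Fin 3, HasBdryValue
    (fun y => angDeriv i j (radDeriv (Φ t)) y - angDeriv i j (Φ t) y) (fun _ => 0)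
  /-- `𝒫_g = Rg T_∞ ϱ` on `∂B₁` -/
  gas_law : HasConstTrace (rho t : Lp ℝ 2 ballMeas) (Pg t / (p.Rgas * p.Tinf))

/-- `(ℛ, Φ_l, ϱ)` is a `C¹([0, ∞))` solution of the linearized system: the remaining unknowns
`𝒫_l`, `𝒫_g`, `Φ_g` exist such that the equations hold for `t > 0`, and `ℛ` is orthogonal to the
spherical harmonics of degree one, that is, to the coordinate functions. -/
structure IsSolution (p : Params) (R : ℝ → Lp ℝ 2 surf) (Φ : ℝ → E3 → ℝ)
    (rho : ℝ → Lp ℝ 2 ballMeas) : Prop where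
  state : IsC1State R Φ rho
  centroid : ∀ t : ℝ, 0 ≤ t → ∀ i : Fin 3, ∫ x : S2, (R t : Lp ℝ 2 surf) x * (x : E3) i ∂surf = 0
  equations : ∃ (Pl : ℝ → E3 → ℝ) (Pg : ℝ → ℝ) (Φg : ℝ → E3 → ℝ),
    ∀ t : ℝ, 0 < t → EquationsAt p R Φ rho Pl Pg Φg t

end Bubble

end

namespace Bubble

open scoped Pointwise
open MvPolynomial

/-! Fix `t > 0` and let `A` be a rotation field. Then `A Φ_l` is harmonic in the exterior, and it
vanishes at infinity because `∇Φ_l = O(|y|⁻²)`. Hence only the modes `r^(-n-1) Y_n` occur in it. The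
tangential stress condition says that `A Φ_l` has `∂_r = 1` as a Robin condition on `r = 1`, that is
`-(n + 1) = 1` on each mode present, which is impossible. So `A Φ_l = 0` for every rotation, and
`Φ_l` is radial (`fieldDeriv_rotGen_eq_zero`, `eq_of_norm_eq`).

By Bernoulli's equation `𝒫_l` is then radial as well, and the normal stress condition makes `(2 +
Δ_S) ℛ` constant. On degree `n` this operator is the factor `2 - n(n+1) = (1 - n)(n + 2)`, which
vanishes only for `n = 1`, the degree excluded by the centroid condition. So `ℛ` is constant
(`ae_const_of_two_add_sphLaplacian`). Both properties are closed in `L²` and pass to `t = 0` by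
continuity. The gas equations play no role.

Homogeneous polynomials replace spherical harmonics as test functions: they are total in `L²(S²)`,
and since they need not be harmonic, each argument is an induction on the degree in which the
Laplacian of the polynomial appears as a source term of degree lower by two. -/

/-! ### Rotation fields, the Euler field and the Laplacian in polar form. -/

/-- The derivative of `u` along the linear vector field `y ↦ J y`. -/
noncomputable def fieldDeriv (J : E3 →L[ℝ] E3) (u : E3 → ℝ) (y : E3) : ℝ := fderiv ℝ u y (J y)

/-- The derivative along the Euler field `y ↦ y`. -/
noncomputable abbrev eulerDeriv : (E3 → ℝ) → E3 → ℝ := fieldDeriv (ContinuousLinearMap.id ℝ E3)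

/-- The generator `y ↦ y_i e_j - y_j e_i` of the rotations in the `(i, j)` plane. -/
noncomputable def rotGen (i j : Fin 3) : E3 →L[ℝ] E3 :=
  (EuclideanSpace.proj i).smulRight (EuclideanSpace.single j (1 : ℝ)) -
    (EuclideanSpace.proj j).smulRight (EuclideanSpace.single i (1 : ℝ))

lemma rotGen_apply (i j : Fin 3) (y : E3) :
    rotGen i j y = y i • EuclideanSpace.single j (1 : ℝ) - y j • EuclideanSpace.single i (1 : ℝ) :=
  rfl

lemma inner_rotGen (i j : Fin 3) (y : E3) : inner ℝ y (rotGen i j y) = 0 := by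
  simp [rotGen_apply, inner_sub_right, inner_smul_right, EuclideanSpace.inner_single_right, mul_comm]

lemma angDeriv_eq (i j : Fin 3) (u : E3 → ℝ) : angDeriv i j u = fieldDeriv (rotGen i j) u := by
  ext y
  simp [angDeriv, fieldDeriv, rotGen_apply]

lemma radDeriv_eq (u : E3 → ℝ) (y : E3) : radDeriv u y = ‖y‖⁻¹ * eulerDeriv u y := by
  simp [radDeriv, fieldDeriv]

/-- The angular part of the Laplacian: the sum of the squares of the three rotation fields. -/
noncomputable def angLap (u : E3 → ℝ) (y : E3) : ℝ :=
  fieldDeriv (rotGen 0 1) (fieldDeriv (rotGen 0 1) u) y +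
  fieldDeriv (rotGen 1 2) (fieldDeriv (rotGen 1 2) u) y +
  fieldDeriv (rotGen 2 0) (fieldDeriv (rotGen 2 0) u) y

lemma contDiffAt_fieldDeriv {n : ℕ} (J : E3 →L[ℝ] E3) {u : E3 → ℝ} {y : E3}
    (hu : ContDiffAt ℝ ((n + 1 : ℕ) : ℕ∞) u y) : ContDiffAt ℝ (n : ℕ∞) (fieldDeriv J u) y :=
  (hu.fderiv_right (m := ((n : ℕ∞) : WithTop ℕ∞)) (by norm_cast)).clm_apply
    J.contDiff.contDiffAt

lemma contDiffAt_one_fieldDeriv (J : E3 →L[ℝ] E3) {u : E3 → ℝ} {y : E3}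
    (hu : ContDiffAt ℝ 2 u y) : ContDiffAt ℝ 1 (fieldDeriv J u) y := by
  simpa using contDiffAt_fieldDeriv (n := 1) J (by simpa using hu)

lemma continuousAt_fieldDeriv (J : E3 →L[ℝ] E3) {u : E3 → ℝ} {y : E3}
    (hu : ContDiffAt ℝ 1 u y) : ContinuousAt (fieldDeriv J u) y :=
  (contDiffAt_fieldDeriv (n := 0) J (by simpa using hu)).continuousAt

lemma fieldDeriv_congr (J : E3 →L[ℝ] E3) {u v : E3 → ℝ} {y : E3} (h : u =ᶠ[𝓝 y] v) :
    fieldDeriv J u y = fieldDeriv J v y := by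
  simp [fieldDeriv, h.fderiv_eq]

lemma fieldDeriv_fieldDeriv (J : E3 →L[ℝ] E3) {u : E3 → ℝ} {y : E3} (hu : ContDiffAt ℝ 2 u y) :
    fieldDeriv J (fieldDeriv J u) y =
      fderiv ℝ (fderiv ℝ u) y (J y) (J y) + fderiv ℝ u y (J (J y)) := by
  have hd : DifferentiableAt ℝ (fderiv ℝ u) y :=
    (hu.fderiv_right (m := 1) (by norm_num)).differentiableAt (by simp)
  have := (hd.hasFDerivAt.clm_apply (J.hasFDerivAt (x := y))).fderiv
  rw [fieldDeriv]
  change fderiv ℝ (fun y => fderiv ℝ u y (J y)) y (J y) = _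
  rw [this]
  simp [add_comm]

lemma eq_sum_single (y : E3) : y = y 0 • EuclideanSpace.single 0 (1 : ℝ) +
    y 1 • EuclideanSpace.single 1 (1 : ℝ) + y 2 • EuclideanSpace.single 2 (1 : ℝ) := by
  ext k
  fin_cases k <;> simp

/-- The Laplacian in polar coordinates. -/
lemma sq_norm_mul_laplacian {u : E3 → ℝ} {y : E3} (hu : ContDiffAt ℝ 2 u y) :
    ‖y‖ ^ 2 * Laplacian.laplacian u y =
      eulerDeriv (eulerDeriv u) y + eulerDeriv u y + angLap u y := by
  have hs : IsSymmSndFDerivAt ℝ u y := hu.isSymmSndFDerivAt (by simp)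
  rw [angLap, fieldDeriv_fieldDeriv _ hu, fieldDeriv_fieldDeriv _ hu, fieldDeriv_fieldDeriv _ hu,
    show eulerDeriv (eulerDeriv u) y = _ from fieldDeriv_fieldDeriv _ hu,
    show eulerDeriv u y = fderiv ℝ u y y from rfl,
    InnerProductSpace.laplacian_eq_iteratedFDeriv_orthonormalBasis u
      (EuclideanSpace.basisFun (Fin 3) ℝ)]
  simp only [iteratedFDeriv_two_apply, Fin.sum_univ_three, EuclideanSpace.basisFun_apply,
    EuclideanSpace.norm_sq_eq, Real.norm_eq_abs, sq_abs, Matrix.cons_val_zero, Matrix.cons_val_one,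
    ContinuousLinearMap.id_apply]
  set B := fderiv ℝ (fderiv ℝ u) y
  set D := fderiv ℝ u y
  have h01 := hs (EuclideanSpace.single 0 (1 : ℝ)) (EuclideanSpace.single 1 (1 : ℝ))
  have h12 := hs (EuclideanSpace.single 1 (1 : ℝ)) (EuclideanSpace.single 2 (1 : ℝ))
  have h02 := hs (EuclideanSpace.single 0 (1 : ℝ)) (EuclideanSpace.single 2 (1 : ℝ))
  have hB : B y y = B (y 0 • EuclideanSpace.single 0 (1 : ℝ) +
      y 1 • EuclideanSpace.single 1 (1 : ℝ) + y 2 • EuclideanSpace.single 2 (1 : ℝ))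
      (y 0 • EuclideanSpace.single 0 (1 : ℝ) +
      y 1 • EuclideanSpace.single 1 (1 : ℝ) + y 2 • EuclideanSpace.single 2 (1 : ℝ)) := by
    rw [← eq_sum_single]
  have hD : D y = D (y 0 • EuclideanSpace.single 0 (1 : ℝ) +
      y 1 • EuclideanSpace.single 1 (1 : ℝ) + y 2 • EuclideanSpace.single 2 (1 : ℝ)) := by
    rw [← eq_sum_single]
  -- First-order terms cancel because the squares of the three generators add up to `-2 id`; the
  -- second-order ones combine because `y ⊗ y` and the three `Jy ⊗ Jy` add up to `|y|²` times the
  -- identity.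
  rw [hB, hD]
  simp only [rotGen_apply, map_sub, map_add, map_smul, sub_apply, add_apply, smul_apply,
    smul_eq_mul]
  simp
  simp only [B, h01, h12, h02]
  ring

lemma fieldDeriv_comp_smul (J : E3 →L[ℝ] E3) (u : E3 → ℝ) (r : ℝ) {y : E3} :
    fieldDeriv J (fun z => u (r • z)) y = fieldDeriv J u (r • y) := by
  simp [fieldDeriv, fderiv_comp_smul]

lemma fieldDeriv_mul (J : E3 →L[ℝ] E3) {u v : E3 → ℝ} {y : E3} (hu : DifferentiableAt ℝ u y)
    (hv : DifferentiableAt ℝ v y) :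
    fieldDeriv J (fun z => u z * v z) y = fieldDeriv J u y * v y + u y * fieldDeriv J v y := by
  simp only [fieldDeriv, fderiv_fun_mul hu hv]
  simp
  ring

/-! ### Integration on the sphere: rotation invariance and integration by parts. -/

lemma norm_coe_sphere (x : S2) : ‖(x : E3)‖ = 1 := by simp

lemma integrable_of_continuous {h : S2 → ℝ} (hh : Continuous h) : Integrable h surf :=
  hh.integrable_of_hasCompactSupport (HasCompactSupport.of_compactSpace h)

/-- Differentiation under the integral over the sphere. -/
lemma hasDerivAt_integral_sphere {k k' : ℝ → S2 → ℝ} {s : Set ℝ} (hs : IsOpen s) {t₀ : ℝ}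
    (ht₀ : t₀ ∈ s) (hk : ∀ t ∈ s, Continuous (k t))
    (hd : ∀ t ∈ s, ∀ x, HasDerivAt (fun t => k t x) (k' t x) t)
    (hk' : ContinuousOn (fun q : ℝ × S2 => k' q.1 q.2) (s ×ˢ univ)) :
    HasDerivAt (fun t => ∫ x, k t x ∂surf) (∫ x, k' t₀ x ∂surf) t₀ := by
  obtain ⟨ε, hε, hball⟩ := Metric.nhds_basis_closedBall.mem_iff.1 (hs.mem_nhds ht₀)
  have hcpt : IsCompact (closedBall t₀ ε ×ˢ (univ : Set S2)) :=
    (isCompact_closedBall t₀ ε).prod isCompact_univ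
  obtain ⟨C, hC⟩ := hcpt.exists_bound_of_continuousOn (hk'.mono (prod_mono hball subset_rfl))
  have hk'c : Continuous (k' t₀) := by
    rw [← continuousOn_univ]
    exact hk'.comp (f := fun x : S2 => (t₀, x)) (by fun_prop) fun x _ => ⟨ht₀, mem_univ _⟩
  refine (hasDerivAt_integral_of_dominated_loc_of_deriv_le (F := k) (F' := k')
    (bound := fun _ => C) (ball_mem_nhds t₀ hε) ?_
    (integrable_of_continuous (hk t₀ ht₀)) hk'c.aestronglyMeasurable ?_
    (integrable_const C) ?_).2
  · filter_upwards [hs.mem_nhds ht₀] with t ht using (hk t ht).aestronglyMeasurable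
  · exact Eventually.of_forall fun x t ht => hC (t, x) ⟨ball_subset_closedBall ht, mem_univ _⟩
  · exact Eventually.of_forall fun x t ht => hd t (hball (ball_subset_closedBall ht)) x

/-- The map of the unit sphere induced by a linear isometry. -/
noncomputable def sphereMap (Q : E3 ≃ₗᵢ[ℝ] E3) (x : S2) : S2 := ⟨Q x, by simp⟩

lemma continuous_sphereMap (Q : E3 ≃ₗᵢ[ℝ] E3) : Continuous (sphereMap Q) :=
  (Q.continuous.comp continuous_subtype_val).subtype_mk _

/-- `surf` measures a set through the volume of the cone over it, and a linear isometry maps cones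
to cones and preserves volume. -/
lemma measurePreserving_sphereMap (Q : E3 ≃ₗᵢ[ℝ] E3) :
    MeasurePreserving (sphereMap Q) surf surf := by
  have hm := (continuous_sphereMap Q).measurable
  refine ⟨hm, ?_⟩
  ext s hs
  rw [Measure.map_apply hm hs, Measure.toSphere_apply' _ hs, Measure.toSphere_apply' _ (hm hs)]
  congr 1
  have : Ioo (0 : ℝ) 1 • ((↑) '' (sphereMap Q ⁻¹' s) : Set E3) =
      Q ⁻¹' (Ioo (0 : ℝ) 1 • ((↑) '' s)) := by
    ext y
    simp only [Set.mem_smul, mem_image, mem_preimage]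
    constructor
    · rintro ⟨c, hc, _, ⟨x, hx, rfl⟩, rfl⟩
      exact ⟨c, hc, _, ⟨_, hx, rfl⟩, by simp [sphereMap]⟩
    · rintro ⟨c, hc, _, ⟨x, hx, rfl⟩, h⟩
      refine ⟨c, hc, _, ⟨sphereMap Q.symm x, ?_, rfl⟩, ?_⟩
      · convert! hx
        ext1
        simp [sphereMap]
      · apply Q.injective
        simp [sphereMap, h]
  rw [this]
  exact Q.measurePreserving.measure_preimage_emb Q.toHomeomorph.measurableEmbedding _

lemma integral_comp_sphereMap (Q : E3 ≃ₗᵢ[ℝ] E3) {h : S2 → ℝ} (hh : Continuous h) :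
    ∫ x, h (sphereMap Q x) ∂surf = ∫ x, h x ∂surf := by
  rw [← (measurePreserving_sphereMap Q).map_eq, integral_map
    (continuous_sphereMap Q).aemeasurable hh.aestronglyMeasurable,
    (measurePreserving_sphereMap Q).map_eq]

/-- The flow of the linear vector field `J`. -/
noncomputable def flow (J : E3 →L[ℝ] E3) (t : ℝ) : E3 →L[ℝ] E3 := NormedSpace.exp (t • J)

lemma hasDerivAt_flow (J : E3 →L[ℝ] E3) (x : E3) (t : ℝ) :
    HasDerivAt (fun t => flow J t x) (J (flow J t x)) t := by
  have h := (hasDerivAt_exp_smul_const' (𝕂 := ℝ) J t).clm_apply (hasDerivAt_const t x)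
  simpa [flow] using h

lemma flow_zero (J : E3 →L[ℝ] E3) (x : E3) : flow J 0 x = x := by
  have h : (0 : ℝ) • J = 0 := zero_smul ℝ J
  rw [flow, h, NormedSpace.exp_zero]
  rfl

lemma continuous_flow (J : E3 →L[ℝ] E3) : Continuous (flow J) :=
  continuous_iff_continuousAt.2 fun t => (hasDerivAt_exp_smul_const (𝕂 := ℝ) J t).continuousAt

lemma norm_flow {J : E3 →L[ℝ] E3} (hJ : ∀ y, inner ℝ y (J y) = 0) (t : ℝ) (x : E3) :
    ‖flow J t x‖ = ‖x‖ := by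
  have hd : ∀ t, HasDerivAt (fun t => ‖flow J t x‖ ^ 2) 0 t := fun t => by
    simpa [hJ] using (hasDerivAt_flow J x t).norm_sq
  have h := is_const_of_deriv_eq_zero (fun t => (hd t).differentiableAt)
    (fun t => (hd t).deriv) t 0
  simp only [flow_zero] at h
  exact (sq_eq_sq₀ (norm_nonneg _) (norm_nonneg _)).1 h

/-- The flow of a skew field, as a linear isometry. -/
noncomputable def flowIsom {J : E3 →L[ℝ] E3} (hJ : ∀ y, inner ℝ y (J y) = 0) (t : ℝ) :
    E3 ≃ₗᵢ[ℝ] E3 :=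
  LinearIsometry.toLinearIsometryEquiv ⟨flow J t, norm_flow hJ t⟩ rfl

lemma flowIsom_apply {J : E3 →L[ℝ] E3} (hJ : ∀ y, inner ℝ y (J y) = 0) (t : ℝ) (x : E3) :
    flowIsom hJ t x = flow J t x := rfl

/-- `u` is `C¹` near the unit sphere. -/
def C1NearSphere (u : E3 → ℝ) : Prop := ∀ x : S2, ContDiffAt ℝ 1 u x

lemma C1NearSphere.mul {u v : E3 → ℝ} (hu : C1NearSphere u) (hv : C1NearSphere v) :
    C1NearSphere fun y => u y * v y := fun x => (hu x).mul (hv x)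

lemma C1NearSphere.continuous {u : E3 → ℝ} (hu : C1NearSphere u) :
    Continuous fun x : S2 => u x :=
  continuous_iff_continuousAt.2 fun x =>
    (hu x).continuousAt.comp (f := ((↑) : S2 → E3)) continuous_subtype_val.continuousAt

lemma C1NearSphere.continuous_fieldDeriv {u : E3 → ℝ} (hu : C1NearSphere u) (J : E3 →L[ℝ] E3) :
    Continuous fun x : S2 => fieldDeriv J u x :=
  continuous_iff_continuousAt.2 fun x =>
    (continuousAt_fieldDeriv J (hu x)).comp (f := ((↑) : S2 → E3))
      continuous_subtype_val.continuousAt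

/-- The integral over the sphere of the derivative along a rotation field vanishes. -/
lemma integral_fieldDeriv_eq_zero {J : E3 →L[ℝ] E3} (hJ : ∀ y, inner ℝ y (J y) = 0)
    {u : E3 → ℝ} (hu : C1NearSphere u) : ∫ x : S2, fieldDeriv J u x ∂surf = 0 := by
  have hQ : Continuous fun q : ℝ × S2 => sphereMap (flowIsom hJ q.1) q.2 := by
    refine Continuous.subtype_mk ?_ _
    exact ((continuous_flow J).comp continuous_fst).clm_apply
      (continuous_subtype_val.comp continuous_snd)
  -- The integral of `u` composed with the flow does not depend on time, by rotation invariance; its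
  -- derivative at time `0` is the integral in question.
  have h := hasDerivAt_integral_sphere (k := fun t x => u (sphereMap (flowIsom hJ t) x))
    (k' := fun t x => fieldDeriv J u (sphereMap (flowIsom hJ t) x)) isOpen_univ (mem_univ 0)
    (fun t _ => hu.continuous.comp (continuous_sphereMap _)) (fun t _ x => ?_)
    ((hu.continuous_fieldDeriv J).comp hQ).continuousOn
  · simp only [fun t => integral_comp_sphereMap (flowIsom hJ t) hu.continuous] at h
    have h0 : ∀ x : S2, sphereMap (flowIsom hJ 0) x = x := fun x => by
      ext1
      simp [sphereMap, flowIsom_apply, flow_zero]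
    simp only [h0] at h
    exact h.unique (hasDerivAt_const _ _)
  · exact ((hu (sphereMap (flowIsom hJ t) x)).differentiableAt (by simp)).hasFDerivAt.comp_hasDerivAt
      t (hasDerivAt_flow J x t)

/-- Integration by parts on the sphere. -/
lemma integral_fieldDeriv_mul {J : E3 →L[ℝ] E3} (hJ : ∀ y, inner ℝ y (J y) = 0)
    {u v : E3 → ℝ} (hu : C1NearSphere u) (hv : C1NearSphere v) :
    ∫ x : S2, fieldDeriv J u x * v x ∂surf = -∫ x : S2, u x * fieldDeriv J v x ∂surf := by
  have h := integral_fieldDeriv_eq_zero hJ (hu.mul hv)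
  simp only [fun x : S2 => fieldDeriv_mul J ((hu x).differentiableAt (by simp))
    ((hv x).differentiableAt (by simp))] at h
  have h1 : Integrable (fun x : S2 => fieldDeriv J u x * v x) surf :=
    integrable_of_continuous ((hu.continuous_fieldDeriv J).mul hv.continuous)
  have h2 : Integrable (fun x : S2 => u x * fieldDeriv J v x) surf :=
    integrable_of_continuous (hu.continuous.mul (hv.continuous_fieldDeriv J))
  rw [integral_add h1 h2] at h
  linarith

lemma integral_fieldDeriv_sq_mul {J : E3 →L[ℝ] E3} (hJ : ∀ y, inner ℝ y (J y) = 0)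
    {u v : E3 → ℝ} (hu : ∀ x : S2, ContDiffAt ℝ 2 u x) (hv : ∀ x : S2, ContDiffAt ℝ 2 v x) :
    ∫ x : S2, fieldDeriv J (fieldDeriv J u) x * v x ∂surf =
      ∫ x : S2, u x * fieldDeriv J (fieldDeriv J v) x ∂surf := by
  rw [integral_fieldDeriv_mul hJ (fun x => contDiffAt_one_fieldDeriv J (hu x))
    (fun x => (hv x).of_le (by norm_num)), integral_fieldDeriv_mul hJ
    (fun x => (hu x).of_le (by norm_num)) (fun x => contDiffAt_one_fieldDeriv J (hv x)), neg_neg]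

lemma continuous_fieldDeriv_sq (J : E3 →L[ℝ] E3) {u : E3 → ℝ}
    (hu : ∀ x : S2, ContDiffAt ℝ 2 u x) :
    Continuous fun x : S2 => fieldDeriv J (fieldDeriv J u) x :=
  C1NearSphere.continuous_fieldDeriv (fun x => contDiffAt_one_fieldDeriv J (hu x)) J

/-- The angular Laplacian is symmetric. -/
lemma integral_angLap_mul {u v : E3 → ℝ} (hu : ∀ x : S2, ContDiffAt ℝ 2 u x)
    (hv : ∀ x : S2, ContDiffAt ℝ 2 v x) :
    ∫ x : S2, angLap u x * v x ∂surf = ∫ x : S2, u x * angLap v x ∂surf := by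
  have hu0 : Continuous fun x : S2 => u x :=
    C1NearSphere.continuous fun x => (hu x).of_le (by norm_num)
  have hv0 : Continuous fun x : S2 => v x :=
    C1NearSphere.continuous fun x => (hv x).of_le (by norm_num)
  have h1 : ∀ i j, Integrable
      (fun x : S2 => fieldDeriv (rotGen i j) (fieldDeriv (rotGen i j) u) x * v x) surf :=
    fun i j => integrable_of_continuous ((continuous_fieldDeriv_sq _ hu).mul hv0)
  have h2 : ∀ i j, Integrable
      (fun x : S2 => u x * fieldDeriv (rotGen i j) (fieldDeriv (rotGen i j) v) x) surf :=
    fun i j => integrable_of_continuous (hu0.mul (continuous_fieldDeriv_sq _ hv))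
  simp only [angLap, add_mul, mul_add]
  rw [integral_add (by exact (h1 _ _).add (h1 _ _)) (h1 _ _), integral_add (h1 _ _) (h1 _ _),
    integral_add (by exact (h2 _ _).add (h2 _ _)) (h2 _ _), integral_add (h2 _ _) (h2 _ _),
    integral_fieldDeriv_sq_mul (inner_rotGen 0 1) hu hv,
    integral_fieldDeriv_sq_mul (inner_rotGen 1 2) hu hv,
    integral_fieldDeriv_sq_mul (inner_rotGen 2 0) hu hv]

/-! ### Moments over spheres and the Euler equation. -/

lemma isOpen_exterior : IsOpen exterior := isOpen_lt continuous_const continuous_norm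

lemma smul_mem_exterior {r : ℝ} (hr : 1 < r) (x : S2) : r • (x : E3) ∈ exterior := by
  simp [exterior, norm_smul, abs_of_pos (zero_lt_one.trans hr), hr]

/-- The integral of `f` on the sphere of radius `r` against `ψ`. -/
noncomputable def sphMoment (f ψ : E3 → ℝ) (r : ℝ) : ℝ := ∫ x : S2, f (r • (x : E3)) * ψ x ∂surf

lemma continuous_comp_smul {f : E3 → ℝ} (hf : ContinuousOn f exterior) {r : ℝ} (hr : 1 < r) :
    Continuous fun x : S2 => f (r • (x : E3)) :=
  hf.comp_continuous (by fun_prop) (smul_mem_exterior hr)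

lemma hasDerivAt_sphMoment {f ψ : E3 → ℝ} (hf : ∀ y ∈ exterior, ContDiffAt ℝ 1 f y)
    (hψ : Continuous ψ) {r : ℝ} (hr : 1 < r) :
    HasDerivAt (sphMoment f ψ) (r⁻¹ * sphMoment (eulerDeriv f) ψ r) r := by
  have h := hasDerivAt_integral_sphere (k := fun r x => f (r • (x : E3)) * ψ x)
    (k' := fun r x => fderiv ℝ f (r • (x : E3)) x * ψ x) isOpen_Ioi (mem_Ioi.2 hr) ?_ ?_ ?_
  · convert! h using 1
    rw [sphMoment, ← integral_const_mul]
    congr 1 with x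
    have : r ≠ 0 := by positivity
    simp [fieldDeriv]
    field_simp
  · exact fun t ht => (continuous_comp_smul (fun y hy => (hf y hy).continuousAt.continuousWithinAt)
      ht).mul (by fun_prop)
  · intro t ht x
    have h1 := ((hf _ (smul_mem_exterior ht x)).differentiableAt
      (by simp)).hasFDerivAt.comp_hasDerivAt t ((hasDerivAt_id t).smul_const (x : E3))
    simpa using h1.mul_const (ψ x)
  · refine ContinuousOn.mul ?_ (by fun_prop)
    have hfd : ContinuousOn (fderiv ℝ f) exterior := fun y hy =>
      ((hf y hy).fderiv_right (m := 0) (by norm_num)).continuousAt.continuousWithinAt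
    exact (hfd.comp (f := fun q : ℝ × S2 => q.1 • (q.2 : E3)) (by fun_prop)
      fun q hq => smul_mem_exterior hq.1 q.2).clm_apply (by fun_prop)

/-- The Euler equation `θ² F + θ F = n (n + 1) F`, `θ = r d/dr`, has no nonzero solution on
`(1, ∞)` that vanishes at infinity and satisfies `F' = F` at `r = 1`. -/
lemma euler_ode_eq_zero (n : ℕ) {F F₁ F₂ : ℝ → ℝ}
    (hF : ∀ r, 1 < r → HasDerivAt F (r⁻¹ * F₁ r) r)
    (hF₁ : ∀ r, 1 < r → HasDerivAt F₁ (r⁻¹ * F₂ r) r)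
    (hode : ∀ r, 1 < r → F₂ r + F₁ r = n * (n + 1) * F r)
    (htop : Tendsto F atTop (𝓝 0))
    (hone : Tendsto (fun r => r⁻¹ * F₁ r - F r) (𝓝[>] 1) (𝓝 0)) {r : ℝ} (hr : 1 < r) :
    F r = 0 := by
  have hconst : ∀ g : ℝ → ℝ, (∀ r, 1 < r → HasDerivAt g 0 r) → ∃ c, ∀ r, 1 < r → g r = c := by
    intro g hg
    obtain ⟨c, hc⟩ := isOpen_Ioi.exists_is_const_of_deriv_eq_zero (convex_Ioi (1 : ℝ)).isPreconnected
      (fun r hr => (hg r hr).differentiableAt.differentiableWithinAt)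
      (fun r hr => (hg r hr).deriv)
    exact ⟨c, hc⟩
  have hpow : ∀ (m : ℕ) (r : ℝ), 1 < r → HasDerivAt (fun r : ℝ => (r ^ m)⁻¹)
      (-(m * r⁻¹ * (r ^ m)⁻¹)) r := by
    intro m r hr
    have h0 : r ≠ 0 := by positivity
    convert! (hasDerivAt_pow m r).inv (pow_ne_zero m h0) using 1
    rcases m with _ | m
    · simp
    · simp
      field_simp
      ring
  -- The operator factors as `(θ - n)(θ + n + 1)`, so `G = (θ + n + 1) F` solves `θ G = n G`, and `G
  -- r⁻ⁿ` is constant.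
  obtain ⟨C, hC⟩ := hconst (fun r => (F₁ r + (n + 1) * F r) * (r ^ n)⁻¹) fun r hr => by
    have h0 : r ≠ 0 := by positivity
    convert! ((hF₁ r hr).add ((hF r hr).const_mul ((n : ℝ) + 1))).mul (hpow n r hr) using 1
    have := hode r hr
    simp only [Pi.add_apply]
    field_simp
    linear_combination -this
  have hC' : ∀ r, 1 < r → F₁ r = C * r ^ n - (n + 1) * F r := fun r hr => by
    have h0 : r ≠ 0 := by positivity
    have := hC r hr
    field_simp at this
    linarith
  have hn : (2 * (n : ℝ) + 1) ≠ 0 := by positivity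
  -- What remains is `θ F + (n + 1) F = C rⁿ`, integrated with the factor `r ^ (n + 1)`.
  obtain ⟨D, hD⟩ := hconst
      (fun r => r ^ (n + 1) * F r - C / (2 * n + 1) * r ^ (2 * n + 1)) fun r hr => by
    have h0 : r ≠ 0 := by positivity
    convert! ((hasDerivAt_pow (n + 1) r).mul (hF r hr)).sub
      ((hasDerivAt_pow (2 * n + 1) r).const_mul (C / (2 * n + 1))) using 1
    rw [hC' r hr]
    push_cast
    field_simp
    ring
  have hFr : ∀ r, 1 < r → F r = C / (2 * n + 1) * r ^ n + D * (r ^ (n + 1))⁻¹ := fun r hr => by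
    have h0 : r ≠ 0 := by positivity
    have := hD r hr
    rw [← this]
    field_simp
    ring
  have hinv : Tendsto (fun r : ℝ => (r ^ (n + 1))⁻¹) atTop (𝓝 0) :=
    (tendsto_pow_atTop (by simp)).inv_tendsto_atTop
  -- Since `rⁿ ≥ 1`, also for `n = 0`, this mode cannot decay.
  have hC0 : C = 0 := by
    have h1 : Tendsto (fun r => F r - D * (r ^ (n + 1))⁻¹) atTop (𝓝 0) := by
      simpa using htop.sub (hinv.const_mul D)
    have h2 : ∀ᶠ r in atTop, |C / (2 * n + 1)| ≤ |F r - D * (r ^ (n + 1))⁻¹| := by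
      filter_upwards [eventually_gt_atTop 1] with r hr
      rw [hFr r hr, add_sub_cancel_right, abs_mul]
      refine le_mul_of_one_le_right (abs_nonneg _) ?_
      rw [abs_of_pos (by positivity)]
      exact one_le_pow₀ hr.le
    have h3 := ge_of_tendsto (by simpa using h1.abs) h2
    have h4 : C / (2 * n + 1) = 0 := abs_eq_zero.1 (le_antisymm h3 (abs_nonneg _))
    exact (div_eq_zero_iff.1 h4).resolve_right hn
  -- On the decaying mode `F' - F` tends to `-(n + 2) D` at `r = 1`.
  have hD0 : D = 0 := by
    have h1 : Tendsto (fun r : ℝ => -(n + 1) * r⁻¹ * (D * (r ^ (n + 1))⁻¹)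
        - D * (r ^ (n + 1))⁻¹) (𝓝[>] 1) (𝓝 (-(n + 1) * 1⁻¹ * (D * (1 ^ (n + 1))⁻¹)
        - D * (1 ^ (n + 1))⁻¹)) := by
      refine Tendsto.mono_left (ContinuousAt.tendsto ?_) nhdsWithin_le_nhds
      have : (1 : ℝ) ^ (n + 1) ≠ 0 := by simp
      fun_prop (disch := simp)
    have h2 := tendsto_nhds_unique (h1.congr' ?_) hone
    · have h3 : (n + 2 : ℝ) * D = 0 := by
        simp at h2
        linarith
      exact (mul_eq_zero.1 h3).resolve_left (by positivity)
    · filter_upwards [self_mem_nhdsWithin] with r hr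
      rw [hC' r hr, hFr r hr, hC0]
      ring
  rw [hFr r hr, hC0, hD0]
  simp

/-! ### Polynomials: Laplacian, rotations, homogeneity. -/

/-- The polynomial function on `E3` given by `p`. -/
noncomputable def polyFun (p : MvPolynomial (Fin 3) ℝ) (y : E3) : ℝ :=
  MvPolynomial.eval (fun i => y i) p

lemma hasFDerivAt_polyFun (p : MvPolynomial (Fin 3) ℝ) (y : E3) :
    HasFDerivAt (polyFun p)
      (∑ i, polyFun (pderiv i p) y • (EuclideanSpace.proj i : E3 →L[ℝ] ℝ)) y := by
  induction p using MvPolynomial.induction_on with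
  | C a =>
    have h : polyFun (C a) = fun _ => a := by
      ext y
      simp [polyFun]
    simpa [h, polyFun] using hasFDerivAt_const (𝕜 := ℝ) a y
  | add p q hp hq =>
    convert! hp.add hq using 1
    · ext y
      simp [polyFun]
    · simp [polyFun, add_smul, Finset.sum_add_distrib]
  | mul_X p i hp =>
    convert! hp.mul ((EuclideanSpace.proj i : E3 →L[ℝ] ℝ).hasFDerivAt (x := y)) using 1
    · ext y
      simp [polyFun]
    · ext v
      simp only [polyFun, pderiv_mul, pderiv_X, map_add, map_mul, eval_X, Fin.sum_univ_three,
        add_apply, smul_apply, smul_eq_mul, PiLp.proj_apply]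
      fin_cases i <;> simp <;> ring

lemma contDiff_polyFun (p : MvPolynomial (Fin 3) ℝ) : ContDiff ℝ ∞ (polyFun p) := by
  induction p using MvPolynomial.induction_on with
  | C a => simpa +unfoldPartialApp [polyFun] using contDiff_const (𝕜 := ℝ) (E := E3) (c := a)
  | add p q hp hq => simpa +unfoldPartialApp [polyFun] using hp.add hq
  | mul_X p i hp =>
    simpa +unfoldPartialApp [polyFun] using
      hp.mul (EuclideanSpace.proj i : E3 →L[ℝ] ℝ).contDiff

lemma contDiffAt_polyFun (p : MvPolynomial (Fin 3) ℝ) (y : E3) :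
    ContDiffAt ℝ 2 (polyFun p) y :=
  (contDiff_infty.1 (contDiff_polyFun p) 2).contDiffAt

lemma continuous_polyFun (p : MvPolynomial (Fin 3) ℝ) : Continuous (polyFun p) :=
  (contDiff_polyFun p).continuous

lemma fderiv_polyFun_single (p : MvPolynomial (Fin 3) ℝ) (y : E3) (i : Fin 3) :
    fderiv ℝ (polyFun p) y (EuclideanSpace.single i 1) = polyFun (pderiv i p) y := by
  rw [(hasFDerivAt_polyFun p y).fderiv]
  simp

/-- The algebraic Laplacian of a polynomial. -/
noncomputable def polyLap (p : MvPolynomial (Fin 3) ℝ) : MvPolynomial (Fin 3) ℝ :=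
  ∑ i, pderiv i (pderiv i p)

/-- The derivative of a polynomial along the rotation field of the `(i, j)` plane. -/
noncomputable def polyRot (i j : Fin 3) (p : MvPolynomial (Fin 3) ℝ) : MvPolynomial (Fin 3) ℝ :=
  X i * pderiv j p - X j * pderiv i p

lemma fieldDeriv_rotGen_polyFun (i j : Fin 3) (p : MvPolynomial (Fin 3) ℝ) :
    fieldDeriv (rotGen i j) (polyFun p) = polyFun (polyRot i j p) := by
  ext y
  rw [fieldDeriv, rotGen_apply, map_sub, map_smul, map_smul, fderiv_polyFun_single,
    fderiv_polyFun_single]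
  simp [polyFun, polyRot]

lemma laplacian_polyFun (p : MvPolynomial (Fin 3) ℝ) (y : E3) :
    Laplacian.laplacian (polyFun p) y = polyFun (polyLap p) y := by
  rw [InnerProductSpace.laplacian_eq_iteratedFDeriv_orthonormalBasis _
      (EuclideanSpace.basisFun (Fin 3) ℝ)]
  simp only [polyLap, polyFun, map_sum, iteratedFDeriv_two_apply, EuclideanSpace.basisFun_apply,
    Matrix.cons_val_zero, Matrix.cons_val_one]
  refine Finset.sum_congr rfl fun i _ => ?_
  have hd : DifferentiableAt ℝ (fderiv ℝ (polyFun p)) y :=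
    ((contDiffAt_polyFun p y).fderiv_right (m := 1) (by norm_num)).differentiableAt (by simp)
  change _ = polyFun _ y
  rw [← fderiv_polyFun_single, ← funext (fun z => fderiv_polyFun_single p z i)]
  rw [fderiv_clm_apply hd (differentiableAt_const _)]
  simp

lemma eulerDeriv_polyFun {n : ℕ} {p : MvPolynomial (Fin 3) ℝ} (hp : p.IsHomogeneous n) :
    eulerDeriv (polyFun p) = fun y => n * polyFun p y := by
  ext y
  have h := congrArg (eval (fun i => y i)) hp.sum_X_mul_pderiv
  rw [eulerDeriv, fieldDeriv, (hasFDerivAt_polyFun p y).fderiv]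
  simpa [polyFun, Fin.sum_univ_three, mul_comm] using h

/-- The commutator of two derivations is a derivation, and this one kills the variables. -/
lemma pderiv_comm (a b : Fin 3) (q : MvPolynomial (Fin 3) ℝ) :
    pderiv a (pderiv b q) = pderiv b (pderiv a q) := by
  have h : ⁅pderiv (R := ℝ) a, pderiv b⁆ =
      (0 : Derivation ℝ (MvPolynomial (Fin 3) ℝ) (MvPolynomial (Fin 3) ℝ)) := by
    apply MvPolynomial.derivation_ext
    intro k
    simp [Derivation.commutator_apply, pderiv_X, Pi.single_apply, apply_ite]
  have h2 := congrArg (fun D => D q) h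
  simpa [Derivation.commutator_apply, sub_eq_zero] using h2

/-- The commutator term `2 ∂_i ∂_j` is symmetric in `i` and `j`, hence disappears from the rotation
field in `polyLap_polyRot`. -/
lemma polyLap_X_mul_pderiv (i j : Fin 3) (p : MvPolynomial (Fin 3) ℝ) :
    polyLap (X i * pderiv j p) = 2 * pderiv i (pderiv j p) + X i * pderiv j (polyLap p) := by
  have h : ∀ k, pderiv k (pderiv k (pderiv j p)) = pderiv j (pderiv k (pderiv k p)) := fun k => by
    rw [pderiv_comm k j, pderiv_comm k j]
  simp only [polyLap, Fin.sum_univ_three, map_add, pderiv_mul, pderiv_X, h]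
  fin_cases i <;> simp <;> ring

lemma polyLap_polyRot (i j : Fin 3) (p : MvPolynomial (Fin 3) ℝ) :
    polyLap (polyRot i j p) = polyRot i j (polyLap p) := by
  have h : polyLap (polyRot i j p) = polyLap (X i * pderiv j p) - polyLap (X j * pderiv i p) := by
    simp [polyLap, polyRot]
  rw [h, polyLap_X_mul_pderiv, polyLap_X_mul_pderiv, pderiv_comm j i, polyRot]
  ring

lemma isHomogeneous_polyRot {n : ℕ} {p : MvPolynomial (Fin 3) ℝ} (hp : p.IsHomogeneous n)
    (i j : Fin 3) : (polyRot i j p).IsHomogeneous n := by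
  -- The degree `n - 1` of a derivative truncates at `n = 0`, where multiplying by a variable would
  -- give degree one.
  rcases n with _ | n
  · have h : ∀ k, pderiv k p = 0 := fun k => by
      rw [(totalDegree_eq_zero_iff_eq_C (p := p)).1 (by simpa using hp.totalDegree_le), pderiv_C]
    simpa [polyRot, h] using isHomogeneous_zero _ _ _
  · have h : ∀ a b, (X a * pderiv b p : MvPolynomial (Fin 3) ℝ).IsHomogeneous (n + 1) :=
      fun a b => by simpa [add_comm] using (isHomogeneous_X ℝ a).mul (hp.pderiv (i := b))
    exact (h i j).sub (h j i)

lemma isHomogeneous_polyLap {n : ℕ} {p : MvPolynomial (Fin 3) ℝ} (hp : p.IsHomogeneous n) :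
    (polyLap p).IsHomogeneous (n - 2) :=
  IsHomogeneous.sum _ _ _ fun i _ => (hp.pderiv (i := i)).pderiv

/-- Base of the inductions on the degree, where `n - 2` truncates. -/
lemma polyLap_eq_zero {n : ℕ} {p : MvPolynomial (Fin 3) ℝ} (hp : p.IsHomogeneous n)
    (hn : n < 2) : polyLap p = 0 := by
  refine Finset.sum_eq_zero fun i _ => ?_
  have h : (pderiv i p).IsHomogeneous 0 := by
    have := hp.pderiv (i := i)
    rwa [show n - 1 = 0 by omega] at this
  rw [(totalDegree_eq_zero_iff_eq_C (p := pderiv i p)).1 (by simpa using h.totalDegree_le),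
    pderiv_C]

/-- The angular Laplacian of a homogeneous polynomial on the unit sphere. -/
lemma angLap_polyFun {n : ℕ} {p : MvPolynomial (Fin 3) ℝ} (hp : p.IsHomogeneous n) (x : S2) :
    angLap (polyFun p) x = polyFun (polyLap p) x - n * (n + 1) * polyFun p x := by
  have h := sq_norm_mul_laplacian (contDiffAt_polyFun p (x : E3))
  have h2 : eulerDeriv (fun y => (n : ℝ) * polyFun p y) x = n * (n * polyFun p x) := by
    have h3 : eulerDeriv (polyFun p) x = n * polyFun p x := by rw [eulerDeriv_polyFun hp]
    rw [eulerDeriv, fieldDeriv, fderiv_const_mul ((contDiffAt_polyFun p _).differentiableAt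
      (by simp)), ← h3]
    simp [fieldDeriv]
  rw [eulerDeriv_polyFun hp, h2, norm_coe_sphere, laplacian_polyFun] at h
  linarith

/-! ### The Laplace–Beltrami operator through the extension of degree zero. -/

lemma contDiffAt_comp_normalize {n : WithTop ℕ∞} {u : E3 → ℝ} {y : E3}
    (hu : ContDiffAt ℝ n u (‖y‖⁻¹ • y)) (hy : y ≠ 0) :
    ContDiffAt ℝ n (fun z => u (‖z‖⁻¹ • z)) y :=
  hu.comp (f := fun z : E3 => ‖z‖⁻¹ • z) y (((contDiffAt_norm ℝ hy).inv (norm_ne_zero_iff.2 hy)).smul contDiffAt_id)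

/-- The flow of a skew field preserves the norm and is linear, so it commutes with normalization;
differentiate along it at time `0`. -/
lemma fieldDeriv_comp_normalize {J : E3 →L[ℝ] E3} (hJ : ∀ y, inner ℝ y (J y) = 0) {u : E3 → ℝ}
    {y : E3} (hu : ContDiffAt ℝ 1 u (‖y‖⁻¹ • y)) (hy : y ≠ 0) :
    fieldDeriv J (fun z => u (‖z‖⁻¹ • z)) y = fieldDeriv J u (‖y‖⁻¹ • y) := by
  have h1 := ((contDiffAt_comp_normalize hu hy).differentiableAt
    (by simp)).hasFDerivAt.comp_hasDerivAt_of_eq 0 (hasDerivAt_flow J y 0) (flow_zero J y).symm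
  have h2 := (hu.differentiableAt (by simp)).hasFDerivAt.comp_hasDerivAt_of_eq 0
    ((hasDerivAt_flow J y 0).const_smul ‖y‖⁻¹) (by simp [flow_zero])
  have h3 : (u ∘ (‖y‖⁻¹ • fun t => flow J t y)) =
      (fun z => u (‖z‖⁻¹ • z)) ∘ fun t => flow J t y := by
    ext t
    simp [norm_flow hJ]
  rw [h3] at h2
  simpa [fieldDeriv, flow_zero] using h1.unique h2

lemma eulerDeriv_comp_normalize {u : E3 → ℝ} {y : E3} (hu : ContDiffAt ℝ 1 u (‖y‖⁻¹ • y))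
    (hy : y ≠ 0) : eulerDeriv (fun z => u (‖z‖⁻¹ • z)) y = 0 := by
  have h1 := ((contDiffAt_comp_normalize hu hy).differentiableAt
    (by simp)).hasFDerivAt.comp_hasDerivAt_of_eq 1 ((hasDerivAt_id (1 : ℝ)).smul_const y) (by simp)
  have h2 : HasDerivAt ((fun z => u (‖z‖⁻¹ • z)) ∘ fun t : ℝ => id t • y) 0 1 := by
    refine (hasDerivAt_const (1 : ℝ) (u (‖y‖⁻¹ • y))).congr_of_eventuallyEq ?_
    filter_upwards [lt_mem_nhds one_pos] with t ht
    have : t ≠ 0 := ht.ne'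
    simp only [Function.comp_def, id, norm_smul, Real.norm_eq_abs, abs_of_pos ht, mul_inv,
      smul_smul]
    congr 2
    field_simp
  simpa [fieldDeriv] using h1.unique h2

/-- The Laplace-Beltrami operator in terms of the rotation fields. -/
lemma sphLaplacian_eq_angLap {u : E3 → ℝ} (hu : ∀ y, ContDiffAt ℝ 2 u y) (x : S2) :
    sphLaplacian u x = angLap u x := by
  have hx : (x : E3) ≠ 0 := ne_zero_of_mem_unit_sphere x
  have hne : ∀ᶠ y in 𝓝 (x : E3), y ≠ 0 := isOpen_ne.mem_nhds hx
  have hu1 : ∀ y, ContDiffAt ℝ 1 u y := fun y => (hu y).of_le (by norm_num)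
  have hE : eulerDeriv (fun z => u (‖z‖⁻¹ • z)) =ᶠ[𝓝 (x : E3)] fun _ => 0 :=
    hne.mono fun y hy => eulerDeriv_comp_normalize (hu1 _) hy
  have hA : ∀ i j, fieldDeriv (rotGen i j) (fieldDeriv (rotGen i j) fun z => u (‖z‖⁻¹ • z)) x =
      fieldDeriv (rotGen i j) (fieldDeriv (rotGen i j) u) x := fun i j => by
    have hJ := inner_rotGen i j
    rw [fieldDeriv_congr _ (hne.mono fun y hy => fieldDeriv_comp_normalize hJ (hu1 _) hy),
      fieldDeriv_comp_normalize hJ (contDiffAt_one_fieldDeriv _ (hu _)) hx]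
    simp
  -- The extension is constant along rays, so only the angular part of the polar formula survives.
  have h := sq_norm_mul_laplacian (contDiffAt_comp_normalize (hu _) hx)
  rw [norm_coe_sphere, hE.eq_of_nhds, eulerDeriv, fieldDeriv_congr _ hE] at h
  simp only [angLap, hA] at h
  simpa [sphLaplacian, angLap, fieldDeriv] using h

/-! ### Totality of polynomials on the sphere. -/

/-- Polynomials as continuous functions on the sphere. -/
noncomputable def polyHom : MvPolynomial (Fin 3) ℝ →ₐ[ℝ] C(S2, ℝ) :=
  aeval fun i => ⟨fun x => (x : E3) i, by fun_prop⟩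

lemma polyHom_apply (p : MvPolynomial (Fin 3) ℝ) (x : S2) : polyHom p x = polyFun p x := by
  induction p using MvPolynomial.induction_on with
  | C a => simp [polyHom, polyFun]
  | add p q hp hq => simpa [polyFun] using congrArg₂ (· + ·) hp hq
  | mul_X p i hp =>
    rw [map_mul, ContinuousMap.mul_apply, hp]
    simp [polyFun, polyHom]

/-- Stone–Weierstrass: the coordinates already separate points. -/
lemma denseRange_polyHom : DenseRange polyHom := by
  have hsep : polyHom.range.SeparatesPoints := by
    intro x y hxy
    by_contra! h
    apply hxy
    ext i
    have := h _ ⟨polyHom (X i), ⟨_, rfl⟩, rfl⟩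
    simpa [polyHom_apply, polyFun] using this
  have h := ContinuousMap.subalgebra_topologicalClosure_eq_top_of_separatesPoints _ hsep
  intro c
  have hc : c ∈ polyHom.range.topologicalClosure := by rw [h]; trivial
  exact hc

/-- Polynomials are total in `L²` of the sphere. -/
lemma Lp_eq_zero_of_integral_polyFun {w : Lp ℝ 2 surf}
    (h : ∀ p, ∫ x : S2, w x * polyFun p x ∂surf = 0) : w = 0 := by
  have hd : DenseRange fun p => ContinuousMap.toLp 2 surf ℝ (polyHom p) :=
    (ContinuousMap.toLp_denseRange ℝ surf ℝ (by norm_num)).comp denseRange_polyHom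
      (ContinuousMap.toLp 2 surf ℝ).continuous
  have h0 : ∀ v, inner ℝ w v = 0 := by
    intro v
    refine hd.induction_on (p := fun v => inner ℝ w v = 0) v
      (isClosed_eq (by fun_prop) continuous_const) fun p => ?_
    rw [L2.inner_def, ← h p]
    refine integral_congr_ae ?_
    filter_upwards [ContinuousMap.coeFn_toLp (p := 2) (𝕜 := ℝ) surf (polyHom p)] with x hx
    rw [hx, polyHom_apply]
    simp [mul_comm]
  exact inner_self_eq_zero.1 (h0 w)

lemma eq_zero_of_integral_polyFun {h : S2 → ℝ} (hh : Continuous h)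
    (h0 : ∀ p, ∫ x : S2, h x * polyFun p x ∂surf = 0) : h = 0 := by
  have hae := ContinuousMap.coeFn_toLp (p := 2) (𝕜 := ℝ) surf ⟨h, hh⟩
  have hz := Lp_eq_zero_of_integral_polyFun (w := ContinuousMap.toLp 2 surf ℝ ⟨h, hh⟩) fun p => by
    rw [← h0 p]
    refine integral_congr_ae ?_
    filter_upwards [hae] with x hx
    rw [hx]
    rfl
  rw [hz] at hae
  refine (Continuous.ae_eq_iff_eq surf hh continuous_zero).1 ?_
  exact hae.symm.trans (Lp.coeFn_zero ℝ 2 surf)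

/-! ### Vanishing of the angular derivatives of the liquid potential. -/

lemma angLap_comp_smul (u : E3 → ℝ) (r : ℝ) (y : E3) :
    angLap (fun z => u (r • z)) y = angLap u (r • y) := by
  have h : ∀ J : E3 →L[ℝ] E3, fieldDeriv J (fun z => u (r • z)) =
      fun z => fieldDeriv J u (r • z) := fun J => funext fun y => fieldDeriv_comp_smul J u r
  simp only [angLap, h, fieldDeriv_comp_smul]

lemma contDiffAt_comp_smul {n : WithTop ℕ∞} {f : E3 → ℝ}
    (hf : ∀ y ∈ exterior, ContDiffAt ℝ n f y) {r : ℝ} (hr : 1 < r) (x : S2) :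
    ContDiffAt ℝ n (fun z => f (r • z)) x :=
  (hf _ (smul_mem_exterior hr x)).comp (x : E3) (contDiffAt_id.const_smul r)

lemma sphMoment_angLap {f ψ : E3 → ℝ} (hf : ∀ y ∈ exterior, ContDiffAt ℝ 2 f y)
    (hψ : ∀ y, ContDiffAt ℝ 2 ψ y) {r : ℝ} (hr : 1 < r) :
    sphMoment (angLap f) ψ r = sphMoment f (angLap ψ) r := by
  have h := integral_angLap_mul (contDiffAt_comp_smul hf hr) (fun x => hψ x)
  simpa only [sphMoment, angLap_comp_smul] using h

lemma sphMoment_fieldDeriv {J : E3 →L[ℝ] E3} (hJ : ∀ y, inner ℝ y (J y) = 0) {f ψ : E3 → ℝ}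
    (hf : ∀ y ∈ exterior, ContDiffAt ℝ 1 f y) (hψ : ∀ y, ContDiffAt ℝ 1 ψ y) {r : ℝ}
    (hr : 1 < r) : sphMoment (fieldDeriv J f) ψ r = -sphMoment f (fieldDeriv J ψ) r := by
  have h := integral_fieldDeriv_mul hJ (contDiffAt_comp_smul hf hr) (fun x => hψ x)
  simpa only [sphMoment, fieldDeriv_comp_smul] using h

lemma integrable_sphMoment {f ψ : E3 → ℝ} (hf : ∀ y ∈ exterior, ContinuousAt f y)
    (hψ : Continuous ψ) {r : ℝ} (hr : 1 < r) :
    Integrable (fun x : S2 => f (r • (x : E3)) * ψ x) surf :=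
  integrable_of_continuous ((continuous_comp_smul
    (fun y hy => (hf y hy).continuousWithinAt) hr).mul (by fun_prop))

/-- The moments of a harmonic function against a homogeneous polynomial satisfy an inhomogeneous
Euler equation. -/
lemma sphMoment_euler {f : E3 → ℝ} (hf : InnerProductSpace.HarmonicOnNhd f exterior) {n : ℕ}
    {q : MvPolynomial (Fin 3) ℝ} (hq : q.IsHomogeneous n) {r : ℝ} (hr : 1 < r) :
    sphMoment (eulerDeriv (eulerDeriv f)) (polyFun q) r + sphMoment (eulerDeriv f) (polyFun q) r =
      n * (n + 1) * sphMoment f (polyFun q) r - sphMoment f (polyFun (polyLap q)) r := by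
  have hf2 : ∀ y ∈ exterior, ContDiffAt ℝ 2 f y := fun y hy => (hf y hy).1
  have hf0 : ∀ y ∈ exterior, ContinuousAt f y := fun y hy => (hf2 y hy).continuousAt
  have hf1 : ∀ y ∈ exterior, ContDiffAt ℝ 1 f y := fun y hy => (hf2 y hy).of_le (by norm_num)
  have hE : ∀ y ∈ exterior, ContinuousAt (eulerDeriv f) y :=
    fun y hy => continuousAt_fieldDeriv _ (hf1 y hy)
  have hEE : ∀ y ∈ exterior, ContinuousAt (eulerDeriv (eulerDeriv f)) y :=
    fun y hy => continuousAt_fieldDeriv _ (contDiffAt_one_fieldDeriv _ (hf2 y hy))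
  -- Harmonicity in polar form. The angular Laplacian then moves onto `q`, where it yields the
  -- factor `-n(n+1)` and, `q` not being harmonic in general, the source `polyLap q`.
  have h1 : sphMoment (eulerDeriv (eulerDeriv f)) (polyFun q) r +
      sphMoment (eulerDeriv f) (polyFun q) r = -sphMoment (angLap f) (polyFun q) r := by
    rw [sphMoment, sphMoment, sphMoment, ← integral_add
      (integrable_sphMoment hEE (continuous_polyFun q) hr)
      (integrable_sphMoment hE (continuous_polyFun q) hr), ← integral_neg]
    congr 1 with x
    have h := sq_norm_mul_laplacian (hf2 _ (smul_mem_exterior hr x))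
    rw [(hf _ (smul_mem_exterior hr x)).2.eq_of_nhds] at h
    simp only [Pi.zero_apply, mul_zero] at h
    linear_combination -(polyFun q x) * h
  rw [h1, sphMoment_angLap hf2 (contDiffAt_polyFun q) hr, sphMoment, sphMoment, sphMoment,
    ← integral_const_mul, ← integral_sub
      ((integrable_sphMoment hf0 (continuous_polyFun q) hr).const_mul _)
      (integrable_sphMoment hf0 (continuous_polyFun _) hr), ← integral_neg]
  congr 1 with x
  rw [angLap_polyFun hq]
  ring

/-- A linear field has size `O(r)` on the sphere of radius `r`, so against a gradient `O(r⁻²)` the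
moment is `O(r⁻¹)`. -/
lemma tendsto_sphMoment_fieldDeriv (J : E3 →L[ℝ] E3) {f ψ : E3 → ℝ} (hψ : Continuous ψ)
    (hgrad : (fun y => fderiv ℝ f y) =O[Bornology.cobounded E3] (fun y => ‖y‖ ^ (-2 : ℤ))) :
    Tendsto (sphMoment (fieldDeriv J f) ψ) atTop (𝓝 0) := by
  obtain ⟨C, hC0, hC⟩ := hgrad.exists_pos
  obtain ⟨M, hM⟩ := isCompact_univ.exists_bound_of_continuousOn
    (f := fun x : S2 => ψ x) (by fun_prop)
  have hbd := hC.bound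
  rw [← comap_norm_atTop] at hbd
  obtain ⟨s, hs, hsub⟩ := hbd
  have hlim : Tendsto (fun r : ℝ => C * ‖J‖ * M * surf.real univ * r⁻¹) atTop (𝓝 0) := by
    simpa using tendsto_inv_atTop_zero.const_mul (C * ‖J‖ * M * surf.real univ)
  refine squeeze_zero_norm' ?_ hlim
  filter_upwards [hs, eventually_gt_atTop 0] with r hrs hr0
  have hb : ∀ x : S2, ‖fieldDeriv J f (r • (x : E3)) * ψ x‖ ≤ C * ‖J‖ * M * r⁻¹ := by
    intro x
    have hn : ‖r • (x : E3)‖ = r := by simp [norm_smul, abs_of_pos hr0]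
    have h1 : ‖fderiv ℝ f (r • (x : E3))‖ ≤ C * ‖‖r • (x : E3)‖ ^ (-2 : ℤ)‖ :=
      hsub (by simpa [hn] using hrs)
    have h2 : ‖fieldDeriv J f (r • (x : E3))‖ ≤ C * ‖J‖ * r⁻¹ := by
      calc ‖fieldDeriv J f (r • (x : E3))‖
          ≤ ‖fderiv ℝ f (r • (x : E3))‖ * (‖J‖ * ‖r • (x : E3)‖) :=
            (ContinuousLinearMap.le_opNorm _ _).trans
              (mul_le_mul_of_nonneg_left (J.le_opNorm _) (norm_nonneg _))
        _ ≤ C * ‖‖r • (x : E3)‖ ^ (-2 : ℤ)‖ * (‖J‖ * ‖r • (x : E3)‖) := by gcongr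
        _ = C * ‖J‖ * r⁻¹ := by
          rw [hn, norm_zpow, Real.norm_of_nonneg hr0.le, zpow_neg]
          field_simp
    rw [norm_mul]
    calc _ ≤ C * ‖J‖ * r⁻¹ * M := by
          gcongr
          exact hM x (mem_univ _)
      _ = _ := by ring
  have := norm_integral_le_of_norm_le_const (μ := surf) (Eventually.of_forall hb)
  refine this.trans (le_of_eq ?_)
  ring

/-- A harmonic function in the exterior with decaying gradient and vanishing tangential stress is
annihilated by the rotation fields. -/
lemma fieldDeriv_rotGen_eq_zero {f : E3 → ℝ} (hf : InnerProductSpace.HarmonicOnNhd f exterior)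
    (hgrad : (fun y => fderiv ℝ f y) =O[Bornology.cobounded E3] (fun y => ‖y‖ ^ (-2 : ℤ)))
    {i j : Fin 3} (htan : HasBdryValue
      (fun y => angDeriv i j (radDeriv f) y - angDeriv i j f y) fun _ => 0)
    {y : E3} (hy : y ∈ exterior) : fieldDeriv (rotGen i j) f y = 0 := by
  have hJ := inner_rotGen i j
  have hf2 : ∀ y ∈ exterior, ContDiffAt ℝ 2 f y := fun y hy => (hf y hy).1
  have hf1 : ∀ y ∈ exterior, ContDiffAt ℝ 1 f y := fun y hy => (hf2 y hy).of_le (by norm_num)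
  have hE1 : ∀ y ∈ exterior, ContDiffAt ℝ 1 (eulerDeriv f) y :=
    fun y hy => contDiffAt_one_fieldDeriv _ (hf2 y hy)
  have hrad1 : ∀ y ∈ exterior, ContDiffAt ℝ 1 (radDeriv f) y := fun y hy => by
    have hy0 : y ≠ 0 := fun h => by
      simp only [exterior, h, Set.mem_ofPred_eq, norm_zero] at hy
      linarith
    rw [funext (radDeriv_eq f)]
    exact ((contDiffAt_norm ℝ hy0).inv (norm_ne_zero_iff.2 hy0)).mul (hE1 y hy)
  have hp1 : ∀ (p) (y : E3), ContDiffAt ℝ 1 (polyFun p) y :=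
    fun p y => (contDiffAt_polyFun p y).of_le (by norm_num)
  -- The moments of `f` against rotated polynomials are, up to sign, those of the rotation
  -- derivative of `f`. This matters because decay and boundary data are available only for that
  -- derivative, not for `f` itself.
  have hA : ∀ p r, 1 < r → sphMoment (fieldDeriv (rotGen i j) f) (polyFun p) r =
      -sphMoment f (polyFun (polyRot i j p)) r := fun p r hr => by
    rw [sphMoment_fieldDeriv hJ hf1 (hp1 p) hr, fieldDeriv_rotGen_polyFun]
  have hone : ∀ p, Tendsto (fun r => r⁻¹ * sphMoment (eulerDeriv f) (polyFun (polyRot i j p)) r -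
      sphMoment f (polyFun (polyRot i j p)) r) (𝓝[>] 1) (𝓝 0) := fun p => by
    rw [← neg_zero]
    refine (htan _ (contDiff_polyFun p)).neg.congr' ?_
    filter_upwards [self_mem_nhdsWithin] with r hr
    have h1 : sphMoment (fieldDeriv (rotGen i j) (radDeriv f)) (polyFun p) r =
        -(r⁻¹ * sphMoment (eulerDeriv f) (polyFun (polyRot i j p)) r) := by
      rw [sphMoment_fieldDeriv hJ hrad1 (hp1 p) hr, fieldDeriv_rotGen_polyFun, sphMoment,
        sphMoment, ← integral_const_mul]
      congr 2 with x
      rw [radDeriv_eq, norm_smul, norm_coe_sphere, Real.norm_of_nonneg (zero_lt_one.trans hr).le]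
      ring
    have h2 := hA p r hr
    simp only [angDeriv_eq, sub_mul]
    rw [integral_sub
      (integrable_sphMoment (fun y hy => continuousAt_fieldDeriv _ (hrad1 y hy))
        (continuous_polyFun p) hr)
      (integrable_sphMoment (fun y hy => continuousAt_fieldDeriv _ (hf1 y hy))
        (continuous_polyFun p) hr)]
    simp only [sphMoment] at h1 h2 ⊢
    rw [h1, h2]
    ring
  have hhom : ∀ n p, p.IsHomogeneous n → ∀ r, 1 < r →
      sphMoment f (polyFun (polyRot i j p)) r = 0 := by
    intro n
    induction n using Nat.strong_induction_on with
    | _ n ih =>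
      intro p hp r hr
      -- The source term vanishes by induction: the Laplacian commutes with rotations, so it is
      -- again a rotated polynomial, of lower degree. The homogeneous Euler equation remains.
      have hlap : ∀ r, 1 < r → sphMoment f (polyFun (polyLap (polyRot i j p))) r = 0 := by
        intro r hr
        rw [polyLap_polyRot]
        rcases lt_or_ge n 2 with hn | hn
        · rw [polyLap_eq_zero hp hn]
          simp [polyRot, polyFun, sphMoment]
        · exact ih (n - 2) (by omega) _ (isHomogeneous_polyLap hp) r hr
      refine euler_ode_eq_zero n
        (fun r hr => hasDerivAt_sphMoment hf1 (continuous_polyFun _) hr)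
        (fun r hr => hasDerivAt_sphMoment hE1 (continuous_polyFun _) hr)
        (fun r hr => ?_) ?_ (hone p) hr
      · rw [sphMoment_euler hf (isHomogeneous_polyRot hp i j) hr, hlap r hr, sub_zero]
      · rw [← neg_zero]
        refine (tendsto_sphMoment_fieldDeriv (rotGen i j) (continuous_polyFun p) hgrad).neg.congr' ?_
        filter_upwards [eventually_gt_atTop 1] with r hr
        rw [hA p r hr, neg_neg]
  have hall : ∀ p r, 1 < r → sphMoment (fieldDeriv (rotGen i j) f) (polyFun p) r = 0 := by
    intro p r hr
    have hint := fun p => integrable_sphMoment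
      (fun y hy => continuousAt_fieldDeriv (rotGen i j) (hf1 y hy)) (continuous_polyFun p) hr
    have h1 : sphMoment (fieldDeriv (rotGen i j) f) (polyFun p) r =
        ∑ n ∈ Finset.range (p.totalDegree + 1),
          sphMoment (fieldDeriv (rotGen i j) f) (polyFun (homogeneousComponent n p)) r := by
      simp only [sphMoment]
      rw [← integral_finsetSum _ fun n _ => hint _]
      congr 1 with x
      rw [← Finset.mul_sum]
      congr 1
      conv_lhs => rw [← sum_homogeneousComponent p]
      simp [polyFun]
    rw [h1]
    refine Finset.sum_eq_zero fun n _ => ?_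
    rw [hA _ r hr, hhom n _ (homogeneousComponent_isHomogeneous n p) r hr, neg_zero]
  have hy1 : 1 < ‖y‖ := hy
  have hy0 : ‖y‖ ≠ 0 := by positivity
  have h0 := eq_zero_of_integral_polyFun (h := fun x => fieldDeriv (rotGen i j) f (‖y‖ • (x : E3)))
    (continuous_comp_smul (fun y hy => (continuousAt_fieldDeriv _ (hf1 y hy)).continuousWithinAt)
      hy1) fun p => hall p _ hy1
  have h1 := congrFun h0 ⟨‖y‖⁻¹ • y, by simp [norm_smul, hy0]⟩
  simpa [smul_smul, hy0] using h1

/-! ### Radial functions. -/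

/-- A function annihilated by the rotation fields is radial. -/
lemma eq_of_norm_eq {f : E3 → ℝ} (hf : ∀ y ∈ exterior, ContDiffAt ℝ 1 f y)
    (h0 : ∀ i j, ∀ y ∈ exterior, fieldDeriv (rotGen i j) f y = 0) {y z : E3}
    (hy : y ∈ exterior) (hyz : ‖y‖ = ‖z‖) : f y = f z := by
  have hy1 : 1 < ‖y‖ := hy
  set ρ := ‖y‖ with hρ
  have hu : ∀ w : E3, w ≠ 0 → ContDiffAt ℝ 1 (fun v => f (ρ • v)) (‖w‖⁻¹ • w) := fun w hw =>
    contDiffAt_comp_smul hf hy1 ⟨‖w‖⁻¹ • w, by simp [norm_smul, hw]⟩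
  -- Extend `f` from the sphere of radius `ρ` to be constant along rays. The Euler and rotation
  -- fields span all directions off the origin and kill this extension, so its gradient vanishes on
  -- a connected set.
  have hfd : EqOn (fderiv ℝ fun w => f (ρ • (‖w‖⁻¹ • w))) 0 {(0 : E3)}ᶜ := by
    intro w hw
    have hw0 : w ≠ 0 := hw
    have hE := eulerDeriv_comp_normalize (hu w hw0) hw0
    have hA : ∀ i j, fieldDeriv (rotGen i j) (fun w => f (ρ • (‖w‖⁻¹ • w))) w = 0 := fun i j => by
      rw [fieldDeriv_comp_normalize (inner_rotGen i j) (hu w hw0) hw0, fieldDeriv_comp_smul]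
      exact h0 i j _ (smul_mem_exterior hy1 ⟨‖w‖⁻¹ • w, by simp [norm_smul, hw0]⟩)
    set D := fderiv ℝ (fun w => f (ρ • (‖w‖⁻¹ • w))) w with hD
    have hDw : D w = 0 := hE
    have hDA : ∀ i j, w i * D (EuclideanSpace.single j 1) =
        w j * D (EuclideanSpace.single i 1) := fun i j => by
      have := hA i j
      rw [fieldDeriv, rotGen_apply, ← hD, map_sub, map_smul, map_smul] at this
      simpa [sub_eq_zero] using this
    have hDe : ∀ k, D (EuclideanSpace.single k 1) = 0 := fun k => by
      -- From `|w|² e_k = w_k w + ∑ i, w_i (w_i e_k - w_k e_i)`, whose last terms are rotation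
      -- directions.
      have h1 : ‖w‖ ^ 2 * D (EuclideanSpace.single k 1) = w k * D w := by
        have h2 : D w = w 0 * D (EuclideanSpace.single 0 1) + w 1 * D (EuclideanSpace.single 1 1)
            + w 2 * D (EuclideanSpace.single 2 1) := by
          conv_lhs => rw [eq_sum_single w]
          simp
        rw [h2, EuclideanSpace.norm_sq_eq]
        simp only [Fin.sum_univ_three, Real.norm_eq_abs, sq_abs]
        linear_combination w 0 * hDA 0 k + w 1 * hDA 1 k + w 2 * hDA 2 k
      rw [hDw, mul_zero] at h1
      exact (mul_eq_zero.1 h1).resolve_left (by simpa using hw0)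
    ext v
    rw [eq_sum_single v]
    simp [hDe]
  have hconn : IsPreconnected {(0 : E3)}ᶜ :=
    (isConnected_compl_singleton_of_one_lt_rank (by
      rw [← Module.finrank_eq_rank]
      simp) 0).isPreconnected
  have hy0 : y ≠ 0 := norm_pos_iff.1 (by linarith)
  have hz0 : z ≠ 0 := norm_pos_iff.1 (by linarith)
  have h := isOpen_compl_singleton.is_const_of_fderiv_eq_zero hconn
    (fun w hw => ((contDiffAt_comp_normalize (hu w hw) hw).differentiableAt
      (by simp)).differentiableWithinAt) hfd (x := y) (y := z) hy0 hz0
  have hρ0 : ρ ≠ 0 := by positivity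
  simpa [smul_smul, ← hyz, ← hρ, hρ0] using h

/-- `f` is constant on every sphere in the exterior. -/
def IsRadial (f : E3 → ℝ) : Prop := ∀ y z : E3, y ∈ exterior → ‖y‖ = ‖z‖ → f y = f z

/-! ### Solving `(2 + Δ_S) w = k` on the sphere. -/

lemma surf_real_univ_pos : 0 < surf.real univ := by
  have : surf univ ≠ 0 := by
    rw [Ne, Measure.measure_univ_eq_zero]
    exact Measure.toSphere_ne_zero _
  exact ENNReal.toReal_pos this (measure_ne_top _ _)

lemma integrable_Lp_mul (w : Lp ℝ 2 surf) {h : S2 → ℝ} (hh : Continuous h) :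
    Integrable (fun x => w x * h x) surf :=
  (Lp.memLp w).integrable_mul (q := 2)
    (hh.memLp_of_hasCompactSupport (HasCompactSupport.of_compactSpace h))

lemma exists_pderiv_eq_C {p : MvPolynomial (Fin 3) ℝ} (hp : p.IsHomogeneous 1) (i : Fin 3) :
    ∃ c, pderiv i p = C c := by
  have h : (pderiv i p).IsHomogeneous 0 := hp.pderiv
  exact ⟨_, (totalDegree_eq_zero_iff_eq_C (p := pderiv i p)).1 (by simpa using h.totalDegree_le)⟩

/-- By Euler's identity a linear form is the combination of the coordinates with its constant
partial derivatives as coefficients. -/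
lemma integral_eq_zero_of_homogeneous_one {w : Lp ℝ 2 surf}
    (hcent : ∀ i : Fin 3, ∫ x : S2, w x * (x : E3) i ∂surf = 0) {p : MvPolynomial (Fin 3) ℝ}
    (hp : p.IsHomogeneous 1) : ∫ x : S2, w x * polyFun p x ∂surf = 0 := by
  choose c hc using exists_pderiv_eq_C hp
  have h1 : ∀ x : S2, w x * polyFun p x = ∑ i, c i * (w x * (x : E3) i) := fun x => by
    have h := congrArg (eval (fun i => (x : E3) i)) hp.sum_X_mul_pderiv
    simp only [hc, Fin.sum_univ_three, map_add, map_mul, eval_X, eval_C, one_smul] at h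
    rw [polyFun, ← h, Fin.sum_univ_three]
    ring
  have h2 : ∀ i : Fin 3, Integrable (fun x : S2 => c i * (w x * (x : E3) i)) surf :=
    fun i => (integrable_Lp_mul w (by fun_prop)).const_mul _
  simp only [h1]
  rw [integral_finsetSum _ fun i _ => h2 i]
  simp [integral_const_mul, hcent]

/-- The angular Laplacian is symmetric and kills the constant `1`. -/
lemma integral_polyFun_polyLap {n : ℕ} {p : MvPolynomial (Fin 3) ℝ} (hp : p.IsHomogeneous n) :
    ∫ x : S2, polyFun (polyLap p) x ∂surf = n * (n + 1) * ∫ x : S2, polyFun p x ∂surf := by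
  have h := integral_angLap_mul (u := polyFun p) (v := fun _ => 1)
    (fun x => contDiffAt_polyFun p x) (fun x => contDiffAt_const)
  have hz : ∀ x : S2, angLap (fun _ => 1) (x : E3) = 0 := fun x => by
    have hz1 : ∀ J : E3 →L[ℝ] E3, fieldDeriv J (fun _ => (1 : ℝ)) = fun _ => 0 := fun J => by
      ext y
      simp [fieldDeriv]
    have hz0 : ∀ J : E3 →L[ℝ] E3, fieldDeriv J (fun _ => (0 : ℝ)) = fun _ => 0 := fun J => by
      ext y
      simp [fieldDeriv]
    simp [angLap, hz1, hz0]
  simp only [hz, mul_one, mul_zero, integral_zero, angLap_polyFun hp] at h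
  have hint : ∀ q, Integrable (fun x : S2 => polyFun q x) surf := fun q =>
    integrable_of_continuous ((continuous_polyFun q).comp continuous_subtype_val)
  rw [integral_sub (hint _) ((hint _).const_mul _), integral_const_mul] at h
  linarith

/-- A function on the sphere orthogonal to the spherical harmonics of degree one whose image under
`2 + Δ_S` is constant is itself constant. -/
lemma ae_const_of_two_add_sphLaplacian {w : Lp ℝ 2 surf} {k : ℝ}
    (hcent : ∀ i : Fin 3, ∫ x : S2, w x * (x : E3) i ∂surf = 0)
    (h : ∀ p, ∫ x : S2, w x * (2 * polyFun p x + sphLaplacian (polyFun p) x) ∂surf =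
      k * ∫ x : S2, polyFun p x ∂surf) :
    ∃ a, ∀ᵐ x ∂surf, w x = a := by
  have hcont : ∀ q, Continuous fun x : S2 => polyFun q x := fun q =>
    (continuous_polyFun q).comp continuous_subtype_val
  have hintw : ∀ q, Integrable (fun x : S2 => w x * polyFun q x) surf := fun q =>
    integrable_Lp_mul w (hcont q)
  set J : MvPolynomial (Fin 3) ℝ → ℝ := fun p => ∫ x : S2, w x * polyFun p x ∂surf with hJ
  set K : MvPolynomial (Fin 3) ℝ → ℝ := fun p => ∫ x : S2, polyFun p x ∂surf with hK
  have hrec : ∀ (n : ℕ) p, p.IsHomogeneous n →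
      (2 - n * (n + 1)) * J p + J (polyLap p) = k * K p := by
    intro n p hp
    rw [← show _ = k * K p from h p]
    simp only [sphLaplacian_eq_angLap (contDiffAt_polyFun p), angLap_polyFun hp, hJ]
    rw [← integral_const_mul, ← integral_add ((hintw p).const_mul _) (hintw _)]
    congr 1 with x
    ring
  -- The only possible constant, as `(2 + Δ_S) m = 2 m`.
  set m : ℝ := k / 2 with hm
  have hI : ∀ n p, p.IsHomogeneous n → J p = m * K p := by
    intro n
    induction n using Nat.strong_induction_on with
    | _ n ih =>
      intro p hp
      have h1 := hrec n p hp
      have h2 : K (polyLap p) = n * (n + 1) * K p := integral_polyFun_polyLap hp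
      have h3 : J (polyLap p) = m * K (polyLap p) := by
        rcases lt_or_ge n 2 with hn | hn
        · rw [polyLap_eq_zero hp hn]
          simp [hJ, hK, polyFun]
        · exact ih (n - 2) (by omega) _ (isHomogeneous_polyLap hp)
      -- In degree one the factor `2 - n(n+1)` vanishes and the recursion gives nothing; the
      -- centroid condition takes its place, and linear forms have mean zero.
      by_cases hn : n = 1
      · subst hn
        have h4 : K p = 0 := by
          rw [polyLap_eq_zero hp (by norm_num)] at h2
          simp only [hK, polyFun, map_zero, integral_zero] at h2 ⊢
          norm_num at h2
          exact h2
        rw [h4, mul_zero]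
        exact integral_eq_zero_of_homogeneous_one hcent hp
      · have h5 : (2 - n * (n + 1) : ℝ) ≠ 0 := by
          have h6 : (2 - n * (n + 1) : ℝ) = (1 - n) * (n + 2) := by ring
          rw [h6]
          refine mul_ne_zero (sub_ne_zero.2 ?_) (by positivity)
          exact_mod_cast Ne.symm hn
        apply mul_left_cancel₀ h5
        rw [h3, h2] at h1
        rw [hm] at h1 ⊢
        linear_combination h1
  have hIall : ∀ p, J p = m * K p := by
    intro p
    have h1 : J p = ∑ n ∈ Finset.range (p.totalDegree + 1), J (homogeneousComponent n p) := by
      simp only [hJ]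
      rw [← integral_finsetSum _ fun n _ => hintw _]
      congr 1 with x
      rw [← Finset.mul_sum]
      congr 1
      conv_lhs => rw [← sum_homogeneousComponent p]
      simp [polyFun]
    have h2 : K p = ∑ n ∈ Finset.range (p.totalDegree + 1), K (homogeneousComponent n p) := by
      simp only [hK]
      rw [← integral_finsetSum _ fun n _ => integrable_of_continuous (hcont _)]
      congr 1 with x
      conv_lhs => rw [← sum_homogeneousComponent p]
      simp [polyFun]
    rw [h1, h2, Finset.mul_sum]
    exact Finset.sum_congr rfl fun n _ => hI n _ (homogeneousComponent_isHomogeneous n p)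
  have hz : w - Lp.const 2 surf m = 0 := by
    refine Lp_eq_zero_of_integral_polyFun fun p => ?_
    have h1 : ∫ x : S2, (w x * polyFun p x - m * polyFun p x) ∂surf = 0 := by
      rw [integral_sub (hintw p) ((integrable_of_continuous (hcont p)).const_mul _),
        integral_const_mul, sub_eq_zero]
      exact hIall p
    rw [← h1]
    refine integral_congr_ae ?_
    filter_upwards [Lp.coeFn_sub w (Lp.const 2 surf m), Lp.coeFn_const 2 surf m] with x hx hx2
    rw [hx, Pi.sub_apply, hx2]
    simp [sub_mul]
  refine ⟨m, ?_⟩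
  rw [sub_eq_zero.1 hz]
  exact Lp.coeFn_const 2 surf m

/-! ### Radial derivatives and boundary values of radial functions. -/

lemma IsRadial.radDeriv {f : E3 → ℝ} (hf : ∀ y ∈ exterior, DifferentiableAt ℝ f y)
    (hr : IsRadial f) : IsRadial (radDeriv f) := by
  intro y z hy hyz
  have hz : z ∈ exterior := by
    change 1 < ‖z‖
    rw [← hyz]
    exact hy
  have hd : ∀ v ∈ exterior, HasDerivAt (fun t : ℝ => f (t • v)) (eulerDeriv f v) 1 := fun v hv => by
    have h1 := (hf v hv).hasFDerivAt.comp_hasDerivAt_of_eq 1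
      ((hasDerivAt_id (1 : ℝ)).smul_const v) (by simp)
    simpa [Function.comp_def, fieldDeriv] using h1
  have heq : (fun t : ℝ => f (t • y)) =ᶠ[𝓝 1] fun t => f (t • z) := by
    have hopen : ∀ᶠ t : ℝ in 𝓝 1, t • y ∈ exterior :=
      ContinuousAt.eventually_mem (f := fun t : ℝ => t • y) (by fun_prop)
        (isOpen_exterior.mem_nhds (by simpa using hy))
    exact hopen.mono fun t ht => hr _ _ ht (by rw [norm_smul, norm_smul, hyz])
  rw [radDeriv_eq, radDeriv_eq, hyz,
    ((hd y hy).congr_of_eventuallyEq heq.symm).unique (hd z hz)]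

lemma differentiableAt_radDeriv {f : E3 → ℝ} {y : E3} (hf : ContDiffAt ℝ 2 f y)
    (hy : y ∈ exterior) : DifferentiableAt ℝ (radDeriv f) y := by
  have hy1 : 1 < ‖y‖ := hy
  have hy0 : y ≠ 0 := norm_pos_iff.1 (by linarith)
  rw [funext (radDeriv_eq f)]
  exact (((contDiffAt_norm ℝ hy0).inv (norm_ne_zero_iff.2 hy0)).mul
    (contDiffAt_one_fieldDeriv _ hf)).differentiableAt (by simp)

/-- The distributional boundary value of a radial function is a constant. -/
lemma HasBdryValue.exists_const {g : E3 → ℝ} {T : (E3 → ℝ) → ℝ} (hg : IsRadial g)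
    (h : HasBdryValue g T) :
    ∃ k, ∀ ψ : E3 → ℝ, ContDiff ℝ ∞ ψ → T ψ = k * ∫ x : S2, ψ x ∂surf := by
  have hS := surf_real_univ_pos
  set e : E3 := EuclideanSpace.single 0 1
  have hint : ∀ ψ : E3 → ℝ, ∀ r : ℝ, 1 < r →
      ∫ x : S2, g (r • (x : E3)) * ψ x ∂surf = g (r • e) * ∫ x : S2, ψ x ∂surf := by
    intro ψ r hr
    rw [← integral_const_mul]
    congr 1 with x
    rw [hg _ (r • e) (smul_mem_exterior hr x) (by simp [norm_smul, e])]
  have hlim : ∀ ψ : E3 → ℝ, ContDiff ℝ ∞ ψ →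
      Tendsto (fun r : ℝ => g (r • e) * ∫ x : S2, ψ x ∂surf) (𝓝[>] 1) (𝓝 (T ψ)) := fun ψ hψ =>
    (h ψ hψ).congr' (by filter_upwards [self_mem_nhdsWithin] with r hr using hint ψ r hr)
  -- The test function `1` shows that `g (r • e)` itself converges; its limit is the constant.
  have h1 := (hlim (fun _ => 1) contDiff_const).div_const (surf.real univ)
  simp only [integral_const, smul_eq_mul, mul_one, mul_div_cancel_right₀ _ hS.ne'] at h1
  exact ⟨_, fun ψ hψ => tendsto_nhds_unique (hlim ψ hψ) (h1.mul_const _)⟩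

/-! ### Symmetry of the solution for positive times and at time zero. -/

namespace IsSolution

variable {p : Params} {R : ℝ → Lp ℝ 2 surf} {Φ : ℝ → E3 → ℝ} {rho : ℝ → Lp ℝ 2 ballMeas}

lemma isRadial_of_pos (hmu : 0 < p.muL) (h : IsSolution p R Φ rho) {t : ℝ} (ht : 0 < t) :
    IsRadial (Φ t) := by
  obtain ⟨Pl, Pg, Φg, heq⟩ := h.equations
  have hΦ := h.state.Phi_mem t ht.le
  intro y z hy hyz
  exact eq_of_norm_eq (fun y hy => (hΦ.harmonic y hy).1.of_le (by norm_num))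
    (fun i j y hy => fieldDeriv_rotGen_eq_zero hΦ.harmonic hΦ.grad_decay
      ((heq t ht).tangential_stress hmu i j) hy) hy hyz

/-- `Φ` is radial at all nearby times, so its time derivative and with it `𝒫_l` are radial. The left
side of the normal stress condition is then radial, which forces `(2 + Δ_S) ℛ` to be constant. -/
lemma ae_const_of_pos (hmu : 0 < p.muL) (h : IsSolution p R Φ rho) {t : ℝ} (ht : 0 < t) :
    ∃ a, ∀ᵐ x ∂surf, (R t : Lp ℝ 2 surf) x = a := by
  obtain ⟨Pl, Pg, Φg, heq⟩ := h.equations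
  have hE := heq t ht
  have hΦ := h.state.Phi_mem t ht.le
  have hc2 : ∀ y ∈ exterior, ContDiffAt ℝ 2 (Φ t) y := fun y hy => (hΦ.harmonic y hy).1
  have hrr : IsRadial (Bubble.radDeriv (Bubble.radDeriv (Φ t))) :=
    ((h.isRadial_of_pos hmu ht).radDeriv
      fun y hy => (hc2 y hy).differentiableAt (by norm_num)).radDeriv
        fun y hy => differentiableAt_radDeriv (hc2 y hy) hy
  have hPl : IsRadial (Pl t) := by
    intro y z hy hyz
    have hz : z ∈ exterior := by
      change 1 < ‖z‖
      rw [← hyz]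
      exact hy
    have hev : (fun s => Φ s z) =ᶠ[𝓝 t] fun s => Φ s y := by
      filter_upwards [lt_mem_nhds ht] with s hs
      exact (h.isRadial_of_pos hmu hs y z hy hyz).symm
    have h1 := ((hE.bernoulli y hy).congr_of_eventuallyEq hev).unique (hE.bernoulli z hz)
    have hne : -(1 / (p.rhoL * p.Rstar)) ≠ 0 := by
      have := p.rhoL_pos
      have := p.Rstar_pos
      exact neg_ne_zero.2 (by positivity)
    exact mul_left_cancel₀ hne h1
  obtain ⟨k, hk⟩ := hE.normal_stress.exists_const fun y z hy hyz => by
    rw [hPl y z hy hyz, hrr y z hy hyz]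
  have hne : -(p.sigma / p.Rstar ^ 2) ≠ 0 := by
    have := p.sigma_pos
    have := p.Rstar_pos
    exact neg_ne_zero.2 (by positivity)
  refine ae_const_of_two_add_sphLaplacian (k := k / -(p.sigma / p.Rstar ^ 2))
    (h.centroid t ht.le) fun q => ?_
  rw [div_mul_eq_mul_div, eq_div_iff hne, mul_comm]
  exact hk _ (contDiff_polyFun q)

lemma ae_const (hmu : 0 < p.muL) (h : IsSolution p R Φ rho) {t : ℝ} (ht : 0 ≤ t) :
    ∃ a, ∀ᵐ x ∂surf, (R t : Lp ℝ 2 surf) x = a := by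
  rcases ht.eq_or_lt with rfl | ht
  swap
  · exact h.ae_const_of_pos hmu ht
  have hlim : Tendsto R (𝓝[>] 0) (𝓝 (R 0)) :=
    (h.state.R_C1.continuousOn 0 self_mem_Ici).mono_left (nhdsWithin_mono 0 Ioi_subset_Ici_self)
  -- The constants form a finite-dimensional, hence closed, subspace of `L²(S²)`.
  set V : Submodule ℝ (Lp ℝ 2 surf) := Submodule.span ℝ {Lp.const 2 surf (1 : ℝ)}
  have hmem : R 0 ∈ V := by
    refine V.closed_of_finiteDimensional.mem_of_tendsto hlim ?_
    filter_upwards [self_mem_nhdsWithin] with t ht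
    obtain ⟨a, ha⟩ := h.ae_const_of_pos hmu ht
    refine Submodule.mem_span_singleton.2 ⟨a, Lp.ext ?_⟩
    filter_upwards [ha, Lp.coeFn_smul a (Lp.const 2 surf (1 : ℝ)),
      Lp.coeFn_const 2 surf (1 : ℝ)] with x hx hx1 hx2
    rw [hx, hx1, Pi.smul_apply, hx2]
    simp
  obtain ⟨a, ha⟩ := Submodule.mem_span_singleton.1 hmem
  refine ⟨a, ?_⟩
  rw [← ha]
  filter_upwards [Lp.coeFn_smul a (Lp.const 2 surf (1 : ℝ)),
    Lp.coeFn_const 2 surf (1 : ℝ)] with x hx1 hx2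
  rw [hx1, Pi.smul_apply, hx2]
  simp

lemma isRadial (hmu : 0 < p.muL) (h : IsSolution p R Φ rho) {t : ℝ} (ht : 0 ≤ t) :
    IsRadial (Φ t) := by
  rcases ht.eq_or_lt with rfl | ht
  swap
  · exact h.isRadial_of_pos hmu ht
  intro y z hy hyz
  have hy1 : 1 < ‖y‖ := hy
  -- The reflection exchanging `y` and `z`. Invariance under it is a closed condition in `L²` of a
  -- shell containing `y`, so it survives as `t ↓ 0`; continuity of `Φ 0` then turns equality almost
  -- everywhere into equality at `y`.
  set Q : E3 ≃ₗᵢ[ℝ] E3 := (ℝ ∙ (y - z))ᗮ.reflection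
  have hQy : Q y = z := Submodule.reflection_sub hyz
  set ρ := ‖y‖ + 1
  obtain ⟨u, hu, huΦ⟩ := h.state.Phi_C1 ρ (by linarith)
  set S : Set E3 := {y | 1 < ‖y‖ ∧ ‖y‖ < ρ} with hS
  have hSo : IsOpen S :=
    (isOpen_lt continuous_const continuous_norm).inter (isOpen_lt continuous_norm continuous_const)
  have hQS : Q ⁻¹' S = S := by
    ext v
    simp [hS]
  have hQ : MeasurePreserving Q (shellMeas ρ) (shellMeas ρ) := by
    have := Q.measurePreserving.restrict_preimage hSo.measurableSet
    rwa [hQS] at this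
  have hpull : ∀ t, 0 ≤ t → (Lp.compMeasurePreserving Q hQ (u t) : E3 → ℝ) =ᵐ[shellMeas ρ]
      fun v => Φ t (Q v) := fun t ht =>
    (Lp.coeFn_compMeasurePreserving (u t) hQ).trans
      (hQ.quasiMeasurePreserving.ae_eq_comp (huΦ t ht))
  have hlim : Tendsto u (𝓝[>] 0) (𝓝 (u 0)) :=
    (hu.continuousOn 0 self_mem_Ici).mono_left (nhdsWithin_mono 0 Ioi_subset_Ici_self)
  have hcl : IsClosed {v : Lp ℝ 2 (shellMeas ρ) | Lp.compMeasurePreserving Q hQ v = v} :=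
    isClosed_eq (Lp.isometry_compMeasurePreserving hQ).continuous continuous_id
  have h0 : Lp.compMeasurePreserving Q hQ (u 0) = u 0 := by
    refine hcl.mem_of_tendsto hlim ?_
    filter_upwards [self_mem_nhdsWithin] with t ht
    have ht' : 0 < t := ht
    refine Lp.ext ((hpull t ht'.le).trans (EventuallyEq.trans ?_ (huΦ t ht'.le).symm))
    filter_upwards [ae_restrict_mem hSo.measurableSet] with v hv
    exact (h.isRadial_of_pos hmu ht' v (Q v) hv.1 (by simp)).symm
  have hcont : ContinuousOn (Φ 0) S :=
    ((h.state.Phi_mem 0 le_rfl).harmonic.continuousOn).mono fun v hv => hv.1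
  have hae : Φ 0 =ᵐ[shellMeas ρ] fun v => Φ 0 (Q v) := by
    refine (huΦ 0 le_rfl).symm.trans ?_
    rw [← h0]
    exact hpull 0 le_rfl
  have heq := Measure.eqOn_open_of_ae_eq hae hSo hcont
    (hcont.comp Q.continuous.continuousOn hQS.ge)
  exact (heq (x := y) ⟨hy1, by linarith⟩).trans (congrArg (Φ 0) hQy)

end IsSolution

end Bubble

theorem theorem4p2 (p : Bubble.Params) (hmu : 0 < p.muL)
    (R : ℝ → Lp ℝ 2 Bubble.surf) (Φ : ℝ → Bubble.E3 → ℝ) (rho : ℝ → Lp ℝ 2 Bubble.ballMeas)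
    (hsol : Bubble.IsSolution p R Φ rho) :
    (∃ F : ℝ → ℝ → ℝ, ∀ t : ℝ, 0 ≤ t → ∀ y : Bubble.E3, 1 < ‖y‖ → Φ t y = F ‖y‖ t) ∧
    (∃ a : ℝ → ℝ, ∀ t : ℝ, 0 ≤ t → ∀ᵐ x ∂Bubble.surf, (R t : Lp ℝ 2 Bubble.surf) x = a t) := by
  constructor
  · refine ⟨fun r t => Φ t (r • EuclideanSpace.single 0 1), fun t ht y hy => ?_⟩
    exact hsol.isRadial hmu ht _ _ hy (by simp [norm_smul])
  · choose! a ha using fun (t : ℝ) (ht : 0 ≤ t) => hsol.ae_const hmu ht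
    exact ⟨a, ha⟩
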